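/- Let $q$ be a power (with positive exponent) of a prime $p$ and let $n>1$ be an integer. For $\mathbf b=(b_1,\dots,b_n)\in\mathbb R^n$ put $$g_{\mathbf b}=(x^{2n}+1)+b_1(x^{2n-1}+x)+\cdots+b_{n-1}(x^{n+1}+x^{n-1})+b_nx^n,$$ and let $V_n$ be the set of those $\mathbf b\in\mathbb R^n$ such that all complex roots of $g_{\mathbf b}$ lie on the unit circle. Let $\mathbf e_1,\dots,\mathbf e_n$ be the standard basis of $\mathbb R^n$. Let $\Lambda_q$ be the lattice generated by the vectors $q^{-i/2}\mathbf e_i$ for $1\le i\le n$; let $\Lambda'_q$ be the lattice generated by the same vectors except that $q^{-n/2}\mathbf e_n$ is replaced with $p\,q^{-n/2}\mathbf e_n$; and let $\Lambda''_q$ be the lattice generated by the same vectors as $\Lambda_q$ except that $q^{-n/2}\mathbf e_n$ is replaced with $s\,q^{-n/2}\mathbf e_n$, where $s$ is the smallest power of $p$ such that $q\mid s^2$. Let $$v_n=\frac{2^n}{n!}\prod_{j=1}^n\left(\frac{2j}{2j-1}\right)^{n+1-j},\qquad r(q)=\frac{\varphi(q)}{q},$$ with $\varphi$ Euler's function, and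 let $$c_1=\frac{\sqrt3}{6},\qquad c_2=\frac{2e^{3/2}(1+\sqrt2)\sqrt3\,(1+\sqrt3/162)^3}{3},\qquad c_3=\frac{c_2}{1+\sqrt2}.$$ Then the sets $\Lambda_q\cap V_n$, $\Lambda'_q\cap V_n$ and $\Lambda''_q\cap V_n$ are finite, $$\bigl|\#(\Lambda_q\cap V_n)-\#(\Lambda'_q\cap V_n)-v_n\,r(q)\,q^{n(n+1)/4}\bigr|\le 6^{n^2}c_1^n c_2\,\frac{n(n+1)}{(n-1)!}\,q^{(n+2)(n-1)/4},$$ and $$\#(\Lambda''_q\cap V_n)\le\left(v_n+6^{n^2}c_1^n c_3\,\frac{n(n+1)}{(n-1)!}\right)q^{(n+2)(n-1)/4}.$$ -/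

import Mathlib

namespace UnitCircleLattice

noncomputable section

open Polynomial

/-- For `b = (b₁, …, bₙ)`, the polynomial
`(x^(2n) + 1) + b₁ (x^(2n-1) + x) + ⋯ + b_{n-1} (x^(n+1) + x^(n-1)) + bₙ xⁿ`.
The coordinate `bᵢ` of the usual numbering is `b ⟨i - 1, _⟩`. -/
def g {n : ℕ} (b : Fin n → ℝ) : ℝ[X] :=
  (X ^ (2 * n) + 1) +
    ∑ i : Fin n,
      if (i : ℕ) + 1 < n then
        C (b i) * (X ^ (2 * n - ((i : ℕ) + 1)) + X ^ ((i : ℕ) + 1))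
      else C (b i) * X ^ n

/-- The vectors `b` for which all complex roots of `g b` lie on the unit circle. -/
def V (n : ℕ) : Set (Fin n → ℝ) :=
  {b | ∀ z : ℂ, aeval z (g b) = 0 → ‖z‖ = 1}

/-- `v n = (2ⁿ / n!) ∏_{j=1}^{n} (2j / (2j - 1))^(n + 1 - j)`. -/
def v (n : ℕ) : ℝ :=
  (2 : ℝ) ^ n / (n.factorial : ℝ) *
    ∏ j ∈ Finset.Icc 1 n, (2 * (j : ℝ) / (2 * (j : ℝ) - 1)) ^ (n + 1 - j)

/-- `r x = φ(x) / x`, with `φ` Euler's function. -/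
def r (x : ℕ) : ℝ := (x.totient : ℝ) / (x : ℝ)

def c₁ : ℝ := √3 / 6

def c₂ : ℝ := Real.exp (3 / 2) * 2 * (1 + √2) * √3 * (1 + √3 / 162) ^ 3 / 3

def c₃ : ℝ := c₂ / (1 + √2)

/-- The lattice generated by `q^(-i/2) eᵢ` for `1 ≤ i < n` and `t q^(-n/2) eₙ`. -/
def scaledLattice (n q t : ℕ) : AddSubgroup (Fin n → ℝ) :=
  AddSubgroup.closure (Set.range fun i : Fin n =>
    (Pi.single i ((if (i : ℕ) + 1 = n then (t : ℝ) else 1) *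
      (q : ℝ) ^ (-(((i : ℕ) : ℝ) + 1) / 2)) : Fin n → ℝ))

/-- The smallest power of `p` whose square is divisible by `q`. -/
def s (p q : ℕ) : ℕ := sInf {m : ℕ | (∃ k : ℕ, m = p ^ k) ∧ q ∣ m ^ 2}

/-- The lattice `Λ_q`, generated by the `q^(-i/2) eᵢ`. -/
def Lam (n q : ℕ) : AddSubgroup (Fin n → ℝ) := scaledLattice n q 1

/-- The lattice `Λ'_q`: the generator `q^(-n/2) eₙ` is replaced with `p q^(-n/2) eₙ`. -/
def Lam' (n p q : ℕ) : AddSubgroup (Fin n → ℝ) := scaledLattice n q p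

/-- The lattice `Λ''_q`: the generator `q^(-n/2) eₙ` is replaced with `s q^(-n/2) eₙ`. -/
def Lam'' (n p q : ℕ) : AddSubgroup (Fin n → ℝ) := scaledLattice n q (s p q)

end

end UnitCircleLattice

/-! ### Counting integer points by sections along coordinate lines. -/

namespace UnitCircleLattice

open MeasureTheory Finset

/-! All three lattices are diagonal, so each count is a count of integer points in a rescaled copy
of `V n`: volume over covolume, plus an error governed by sections along coordinate lines
(`abs_ncard_int_points_sub_volume_le`).

Dividing `g b` by `z ^ n` gives a monic polynomial of degree `n` in `z + z⁻¹`, and a nonzero `z`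
lies on the unit circle exactly when `z + z⁻¹` is in `[-2, 2]`. Hence `V n` is the image of the cube
`[-2, 2]ⁿ` under the map from roots to coefficients (`V_eq_image`). The Jacobian of this map is the
Vandermonde determinant up to sign (`abs_det_fderiv_coeffMap`), and the map is generically `n!` to
one, so `volume_V` reduces to the integral of the absolute Vandermonde determinant over the cube.
That Selberg integral is evaluated by Aomoto's recursion (`integral_absVandermonde`).

For the error, let `h + t T` be the trace polynomials along a coordinate line. At a frontier value
of `t` one of them has a root at `±2` or a double root. A double root is a zero of the Wronskian of
`h` and `T`, so a degree count leaves at most `2 n` frontier values (`exists_frontier_line_subset`).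
Together with the box given by binomial bounds on the coefficients, this yields
`scaledLattice_inter_V`: with last generator scaled by `t`, the count is `v n * q ^ (n (n + 1) / 4)
/ t` up to a bound `K` independent of `t`.

Taking `t = 1` and `t = p` and subtracting produces the factor `1 - 1 / p = r q`, with error `2 K ≤
(1 + √2) K`. For `t = s`, the inequality `q ≤ s ^ 2` lowers the exponent of the main term by `1 /
2`, to that of the error. -/

/-- Off the frontier, the interior of `A` and the complement of its closure would separate `s`. -/
theorem inter_frontier_nonempty_of_isPreconnected {X : Type*} [TopologicalSpace X] {s A : Set X}
    (hs : IsPreconnected s) (h₁ : (s ∩ A).Nonempty) (h₂ : ∃ x ∈ s, x ∉ A) :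
    (s ∩ frontier A).Nonempty := by
  by_contra hne
  obtain ⟨x, hxs, hxA⟩ := h₁
  obtain ⟨y, hys, hyA⟩ := h₂
  have hsub : s ⊆ interior A ∪ (closure A)ᶜ := by
    intro z hz
    by_contra hz'
    simp only [Set.mem_union, Set.mem_compl_iff, not_or, not_not] at hz'
    exact hne ⟨z, hz, hz'.2, hz'.1⟩
  have hdisj : Disjoint (interior A) (closure A)ᶜ :=
    Set.disjoint_left.2 fun z hz hz' => hz' (subset_closure (interior_subset hz))
  have hx : x ∈ interior A := (hsub hxs).resolve_right fun h => h (subset_closure hxA)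
  have := hs.subset_left_of_subset_union isOpen_interior isClosed_closure.isOpen_compl hdisj hsub
    ⟨x, hxs, hx⟩
  exact hyA (interior_subset (this hys))

/-- If a set of reals in `[-R, R]` has at most `N` frontier points, then the number of integers in it
differs from its length by at most `2 N`. -/
theorem abs_ncard_int_sub_volume_le {A : Set ℝ} (hA : MeasurableSet A) {R : ℝ}
    (hR : ∀ t ∈ A, |t| ≤ R) (F : Finset ℝ) (hF : frontier A ⊆ F) :
    |({k : ℤ | (k : ℝ) ∈ A}.ncard : ℝ) - volume.real A| ≤ 2 * (#F : ℝ) := by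
  classical
  set m : ℤ := ⌈R⌉ + 1 with hm
  have hRm : R + 1 ≤ m := by rw [hm]; push_cast; linarith [Int.le_ceil R]
  set I : Finset ℤ := Finset.Ico (-m) m with hI
  have hmem : ∀ t ∈ A, ⌊t⌋ ∈ I := by
    intro t ht
    have h := abs_le.1 (hR t ht)
    rw [hI, Finset.mem_Ico]
    constructor
    · rw [Int.le_floor]; push_cast; linarith
    · rw [Int.floor_lt]; linarith
  have hcount : ({k : ℤ | (k : ℝ) ∈ A}.ncard : ℝ) = ∑ k ∈ I, (if (k : ℝ) ∈ A then (1 : ℝ) else 0) := by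
    have : {k : ℤ | (k : ℝ) ∈ A} = ↑(I.filter fun k : ℤ => (k : ℝ) ∈ A) := by
      ext k
      simp only [Set.mem_ofPred_eq, Finset.coe_filter]
      exact ⟨fun h => ⟨by simpa using hmem _ h, h⟩, fun h => h.2⟩
    rw [this, Set.ncard_coe_finset, Finset.card_filter]
    push_cast; rfl
  have hfin : ∀ k : ℤ, volume (A ∩ Set.Ico (k : ℝ) (k + 1)) ≠ ⊤ := fun k =>
    ((measure_mono Set.inter_subset_right).trans_lt (by simp)).ne
  have hvol : volume.real A = ∑ k ∈ I, volume.real (A ∩ Set.Ico (k : ℝ) (k + 1)) := by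
    rw [← measureReal_biUnion_finset (h := fun k _ => hfin k)]
    · congr 1
      ext t
      simp only [Set.mem_iUnion, Set.mem_inter_iff, Set.mem_Ico, exists_prop]
      exact ⟨fun h => ⟨⌊t⌋, hmem t h, h, Int.floor_le t, Int.lt_floor_add_one t⟩,
        fun ⟨k, _, h, _⟩ => h⟩
    · intro i _ j _ hij
      refine Set.disjoint_left.2 ?_
      rintro t ⟨-, h1, h2⟩ ⟨-, h3, h4⟩
      apply hij
      rw [← Int.floor_eq_iff.2 ⟨h1, h2⟩, ← Int.floor_eq_iff.2 ⟨h3, h4⟩]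
    · intro k _; exact hA.inter measurableSet_Ico
  -- A half-open unit cell without frontier points lies inside or outside `A` and contributes no
  -- error. Only the cell `⌊f⌋` matters for a frontier point `f`; also allowing `⌊f⌋ - 1` gives the
  -- non-sharp factor 2.
  set J : Finset ℤ := F.biUnion fun f => {⌊f⌋, ⌊f⌋ - 1}
  have hJ : (#J : ℝ) ≤ 2 * (#F : ℝ) := by
    have : #J ≤ #F * 2 := Finset.card_biUnion_le_card_mul _ _ _ fun f _ => Finset.card_le_two
    rw [mul_comm]; exact_mod_cast this
  have hcell : ∀ k : ℤ, |(if (k : ℝ) ∈ A then (1 : ℝ) else 0)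
      - volume.real (A ∩ Set.Ico (k : ℝ) (k + 1))| ≤ if k ∈ J then 1 else 0 := by
    intro k
    have hle : volume.real (A ∩ Set.Ico (k : ℝ) (k + 1)) ≤ 1 := by
      calc _ ≤ volume.real (Set.Ico (k : ℝ) (k + 1)) :=
            measureReal_mono Set.inter_subset_right (by simp)
        _ = 1 := by simp [Measure.real]
    have hge : 0 ≤ volume.real (A ∩ Set.Ico (k : ℝ) (k + 1)) := measureReal_nonneg
    split_ifs with h1 h2 h2
    · rw [abs_le]; constructor <;> linarith
    · have hsub : Set.Ico (k : ℝ) (k + 1) ⊆ A := by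
        by_contra hns
        obtain ⟨f, hf1, hf2⟩ := inter_frontier_nonempty_of_isPreconnected (isPreconnected_Ico
          (a := (k : ℝ)) (b := k + 1)) ⟨k, by simp, h1⟩ (Set.not_subset.1 hns)
        exact h2 (Finset.mem_biUnion.2 ⟨f, hF hf2, by
          simp [Int.floor_eq_iff.2 ⟨hf1.1, hf1.2⟩]⟩)
      rw [Set.inter_eq_right.2 hsub]; simp [Measure.real]
    · rw [abs_le]; constructor <;> linarith
    · have hsub : A ∩ Set.Ico (k : ℝ) (k + 1) = ∅ := by
        by_contra hns
        obtain ⟨f, hf1, hf2⟩ := inter_frontier_nonempty_of_isPreconnected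
          (isPreconnected_Ico (a := (k : ℝ)) (b := k + 1)) (by
            rw [Set.inter_comm]; exact Set.nonempty_iff_ne_empty.2 hns) ⟨k, by simp, h1⟩
        exact h2 (Finset.mem_biUnion.2 ⟨f, hF hf2, by
          simp [Int.floor_eq_iff.2 ⟨hf1.1, hf1.2⟩]⟩)
      rw [hsub]; simp
  rw [hcount, hvol, ← Finset.sum_sub_distrib]
  calc _ ≤ ∑ k ∈ I, |_| := Finset.abs_sum_le_sum_abs _ _
    _ ≤ ∑ k ∈ I, (if k ∈ J then (1 : ℝ) else 0) := Finset.sum_le_sum fun k _ => hcell k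
    _ = (#(I.filter fun k => k ∈ J) : ℝ) := by rw [Finset.card_filter]; push_cast; rfl
    _ ≤ #J := by
      exact_mod_cast Finset.card_le_card fun k hk => (Finset.mem_filter.1 hk).2
    _ ≤ _ := hJ

/-- The integer points of a set contained in a box are finite in number. -/
theorem finite_int_points {n : ℕ} {S : Set (Fin n → ℝ)} {R : Fin n → ℝ}
    (hR : ∀ x ∈ S, ∀ i, |x i| ≤ R i) : {k : Fin n → ℤ | (fun i => (k i : ℝ)) ∈ S}.Finite := by
  refine (Set.finite_Icc (fun i => -⌈R i⌉) (fun i => ⌈R i⌉)).subset ?_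
  intro k hk
  refine ⟨fun i => ?_, fun i => ?_⟩
  · have h := (abs_le.1 (hR _ hk i)).1
    have := Int.le_ceil (R i)
    have : (-(⌈R i⌉ : ℤ) : ℝ) ≤ (k i : ℝ) := by linarith
    exact_mod_cast this
  · exact_mod_cast (abs_le.1 (hR _ hk i)).2.trans (Int.le_ceil (R i))

theorem card_int_Icc_le {R : ℝ} (hR : 0 ≤ R) : (#(Finset.Icc (-⌊R⌋) ⌊R⌋) : ℝ) ≤ 2 * R + 1 := by
  have h0 : 0 ≤ ⌊R⌋ := Int.floor_nonneg.2 hR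
  have h1 : ((#(Finset.Icc (-⌊R⌋) ⌊R⌋) : ℤ) : ℝ) = 2 * ⌊R⌋ + 1 := by
    rw [Int.card_Icc, Int.toNat_of_nonneg (by lia)]; push_cast; ring
  have h2 : ((#(Finset.Icc (-⌊R⌋) ⌊R⌋) : ℤ) : ℝ) = (#(Finset.Icc (-⌊R⌋) ⌊R⌋) : ℝ) := by norm_cast
  rw [← h2, h1]
  linarith [Int.floor_le R]

theorem abs_int_le_iff {R : ℝ} {k : ℤ} : |(k : ℝ)| ≤ R ↔ k ∈ Finset.Icc (-⌊R⌋) ⌊R⌋ := by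
  rw [abs_le, Finset.mem_Icc, Int.le_floor, neg_le (a := ⌊R⌋), Int.le_floor]
  push_cast
  constructor <;> rintro ⟨h1, h2⟩ <;> constructor <;> linarith

/-- Counting integer points of `S ⊆ ℝⁿ⁺¹` by their first coordinate. -/
theorem ncard_int_succ {n : ℕ} {S : Set (Fin (n + 1) → ℝ)} {R : Fin (n + 1) → ℝ}
    (hbox : ∀ x ∈ S, ∀ i, |x i| ≤ R i) :
    {k : Fin (n + 1) → ℤ | (fun i => (k i : ℝ)) ∈ S}.ncard =
      ∑ a ∈ Finset.Icc (-⌊R 0⌋) ⌊R 0⌋,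
        {k : Fin n → ℤ | (Fin.cons (a : ℝ) (fun i => (k i : ℝ)) : Fin (n + 1) → ℝ) ∈ S}.ncard := by
  classical
  have hfin := finite_int_points hbox
  rw [Set.ncard_eq_toFinset_card _ hfin, Finset.card_eq_sum_card_fiberwise
    (f := fun k : Fin (n + 1) → ℤ => k 0) (t := Finset.Icc (-⌊R 0⌋) ⌊R 0⌋)]
  · refine Finset.sum_congr rfl fun a _ => ?_
    rw [← Set.ncard_coe_finset, ← Set.ncard_image_of_injective _ (Fin.cons_right_injective
      (α := fun _ : Fin (n + 1) => ℤ) a)]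
    congr 1
    have hcast : ∀ k : Fin n → ℤ, (fun i => (((Fin.cons a k : Fin (n + 1) → ℤ) i : ℤ) : ℝ)) =
        (Fin.cons (a : ℝ) (fun i => (k i : ℝ)) : Fin (n + 1) → ℝ) := by
      intro k; funext i; refine Fin.cases ?_ (fun j => ?_) i <;> simp
    ext k
    simp only [Finset.coe_filter, Set.Finite.mem_toFinset, Set.mem_ofPred_eq, Set.mem_image]
    constructor
    · rintro ⟨hk, rfl⟩
      refine ⟨Fin.tail k, ?_, Fin.cons_self_tail k⟩
      rw [← hcast, Fin.cons_self_tail]; exact hk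
    · rintro ⟨k', hk', rfl⟩
      exact ⟨by rw [hcast]; exact hk', by simp⟩
  · intro k hk
    have hk' : (fun i => (k i : ℝ)) ∈ S := by simpa using hk
    exact abs_int_le_iff.1 (hbox _ hk' 0)

/-- A set in a box all of whose sections by lines parallel to the axes have as many integer points
as their length, up to `M`, has about as many integer points as its volume. -/
theorem abs_ncard_int_points_sub_volume_le {n : ℕ} {S : Set (Fin n → ℝ)} (hS : MeasurableSet S)
    {R : Fin n → ℝ} (hR : ∀ i, 0 ≤ R i) (hbox : ∀ x ∈ S, ∀ i, |x i| ≤ R i) {M : ℝ} (hM : 0 ≤ M)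
    (hline : ∀ x i, |({k : ℤ | Function.update x i (k : ℝ) ∈ S}.ncard : ℝ)
      - volume.real {t : ℝ | Function.update x i t ∈ S}| ≤ M) :
    |({k : Fin n → ℤ | (fun i => (k i : ℝ)) ∈ S}.ncard : ℝ) - volume.real S|
      ≤ M * ∑ k, ∏ j ∈ univ.erase k, (2 * R j + 1) := by
  induction n with
  | zero =>
    have hsub : ∀ x ∈ S, S = Set.univ := fun x hx =>
      Set.eq_univ_of_forall fun y => Subsingleton.elim x y ▸ hx
    rcases S.eq_empty_or_nonempty with rfl | ⟨x, hx⟩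
    · simp
    · rw [hsub x hx]; simp [Measure.real, volume_pi]
  | succ n ih =>
    set I := Finset.Icc (-⌊R 0⌋) ⌊R 0⌋
    set R' : Fin n → ℝ := fun i => R i.succ
    have hcons : Measurable fun p : ℝ × (Fin n → ℝ) => (Fin.cons p.1 p.2 : Fin (n + 1) → ℝ) := by
      refine measurable_pi_iff.2 fun i => ?_
      refine Fin.cases ?_ (fun j => ?_) i
      · simpa using measurable_fst
      · simp only [Fin.cons_succ]; fun_prop
    set S' : Set (ℝ × (Fin n → ℝ)) := {p | (Fin.cons p.1 p.2 : Fin (n + 1) → ℝ) ∈ S}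
    have hS' : MeasurableSet S' := hcons hS
    have hsl : ∀ a : ℝ, MeasurableSet {y : Fin n → ℝ | (Fin.cons a y : Fin (n + 1) → ℝ) ∈ S} :=
      fun a => measurable_prodMk_left hS'
    have hslt : ∀ y : Fin n → ℝ, MeasurableSet {t : ℝ | (Fin.cons t y : Fin (n + 1) → ℝ) ∈ S} :=
      fun y => measurable_prodMk_right hS'
    set Q : Set (Fin n → ℝ) := Set.Icc (-R') R'
    have hQbox : ∀ a y, (Fin.cons a y : Fin (n + 1) → ℝ) ∈ S → y ∈ Q := by
      intro a y h
      have h' := fun i : Fin n => hbox _ h i.succ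
      simp only [Fin.cons_succ] at h'
      exact ⟨fun i => (abs_le.1 (h' i)).1, fun i => (abs_le.1 (h' i)).2⟩
    have habox : ∀ a y, (Fin.cons a y : Fin (n + 1) → ℝ) ∈ S → a ∈ Set.Icc (-R 0) (R 0) := by
      intro a y h
      have h' := hbox _ h 0
      simp only [Fin.cons_zero] at h'
      exact abs_le.1 h'
    have hQtop : volume Q ≠ ⊤ := isCompact_Icc.measure_ne_top
    have hQvol : volume.real Q = ∏ i, (2 * R' i) := by
      simp only [Measure.real, Q]
      rw [Real.volume_Icc_pi_toReal]
      · refine Finset.prod_congr rfl fun i _ => ?_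
        simp only [Pi.neg_apply]; ring
      · intro i; simp only [Pi.neg_apply]; linarith [hR i.succ]
    have hvolS : volume.real S = (volume : Measure (ℝ × (Fin n → ℝ))).real S' := by
      have hmp := (volume_preserving_piFinSuccAbove (fun _ : Fin (n + 1) => ℝ) 0).symm
      rw [Measure.real, ← hmp.measure_preimage hS.nullMeasurableSet, Measure.real]
      congr 2
      ext p
      simp [S', MeasurableEquiv.piFinSuccAbove, Fin.insertNthEquiv, Fin.insertNth_zero']
    have hS'top : (volume : Measure (ℝ × (Fin n → ℝ))) S' ≠ ⊤ := by
      refine ne_top_of_le_ne_top (b := volume (Set.Icc (-R 0) (R 0) ×ˢ Q)) ?_ (measure_mono ?_)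
      · exact (isCompact_Icc.prod isCompact_Icc).measure_ne_top
      · rintro ⟨a, y⟩ h
        exact ⟨habox a y h, hQbox a y h⟩
    have hint : Integrable (S'.indicator (1 : ℝ × (Fin n → ℝ) → ℝ)) (volume.prod volume) :=
      (integrable_indicator_iff hS').2 (integrableOn_const hS'top)
    have hvol : volume.real S = ∫ y : Fin n → ℝ,
        volume.real {t : ℝ | (Fin.cons t y : Fin (n + 1) → ℝ) ∈ S} := by
      rw [hvolS, ← integral_indicator_one hS', Measure.volume_eq_prod, integral_prod_symm _ hint]
      refine integral_congr_ae (Filter.Eventually.of_forall fun y => ?_)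
      simp only
      rw [← integral_indicator_one (hslt y)]
      rfl
    have hvint : Integrable fun y : Fin n → ℝ =>
        volume.real {t : ℝ | (Fin.cons t y : Fin (n + 1) → ℝ) ∈ S} := by
      refine hint.integral_prod_right.congr (Filter.Eventually.of_forall fun y => ?_)
      simp only
      rw [← integral_indicator_one (hslt y)]
      rfl
    have hslice : ∀ a : ℝ, Integrable (Set.indicator {y : Fin n → ℝ |
        (Fin.cons a y : Fin (n + 1) → ℝ) ∈ S} (1 : (Fin n → ℝ) → ℝ)) := fun a =>
      (integrable_indicator_iff (hsl a)).2 (integrableOn_const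
        (ne_top_of_le_ne_top hQtop (measure_mono fun y hy => hQbox a y hy)))
    have hcnt : ∀ y : Fin n → ℝ,
        ({k : ℤ | (Fin.cons (k : ℝ) y : Fin (n + 1) → ℝ) ∈ S}.ncard : ℝ) =
        ∑ a ∈ I, Set.indicator {y : Fin n → ℝ |
          (Fin.cons (a : ℝ) y : Fin (n + 1) → ℝ) ∈ S} (1 : (Fin n → ℝ) → ℝ) y := by
      classical
      intro y
      have : {k : ℤ | (Fin.cons (k : ℝ) y : Fin (n + 1) → ℝ) ∈ S} =
          ↑(I.filter fun k : ℤ => (Fin.cons (k : ℝ) y : Fin (n + 1) → ℝ) ∈ S) := by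
        ext k
        simp only [Set.mem_ofPred_eq, Finset.coe_filter]
        exact ⟨fun h => ⟨abs_int_le_iff.1 (abs_le.2 (habox _ _ h)), h⟩, fun h => h.2⟩
      rw [this, Set.ncard_coe_finset, Finset.card_filter]
      push_cast
      refine Finset.sum_congr rfl fun a _ => ?_
      simp [Set.indicator_apply]
    have hcons0 : ∀ (t : ℝ) (y : Fin n → ℝ),
        (Fin.cons t y : Fin (n + 1) → ℝ) = Function.update (Fin.cons 0 y : Fin (n + 1) → ℝ) 0 t := by
      intro t y; rw [Fin.update_cons_zero]
    -- By Fubini, the sum of the volumes of the integer slices is the integral over `y` of the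
    -- number of integers on the line through `y`, while the volume of `S` is the integral of the
    -- lengths. The line hypothesis compares the integrands on the box `Q`.
    have hstep₁ : |∑ a ∈ I, volume.real {y : Fin n → ℝ | (Fin.cons (a : ℝ) y : Fin (n + 1) → ℝ) ∈ S}
        - volume.real S| ≤ M * ∏ i, (2 * R' i) := by
      have h1 : ∑ a ∈ I, volume.real {y : Fin n → ℝ | (Fin.cons (a : ℝ) y : Fin (n + 1) → ℝ) ∈ S} =
          ∫ y : Fin n → ℝ, ({k : ℤ | (Fin.cons (k : ℝ) y : Fin (n + 1) → ℝ) ∈ S}.ncard : ℝ) := by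
        simp_rw [hcnt]
        rw [integral_finsetSum _ fun a _ => hslice (a : ℤ)]
        exact Finset.sum_congr rfl fun a _ => (integral_indicator_one (hsl a)).symm
      have hcint : Integrable fun y : Fin n → ℝ =>
          ({k : ℤ | (Fin.cons (k : ℝ) y : Fin (n + 1) → ℝ) ∈ S}.ncard : ℝ) := by
        simp_rw [hcnt]
        exact integrable_finsetSum _ fun a _ => hslice a
      rw [h1, hvol, ← integral_sub hcint hvint, ← setIntegral_eq_integral_of_forall_compl_eq_zero
        (s := Q), ← Real.norm_eq_abs, ← hQvol]
      · refine norm_setIntegral_le_of_norm_le_const hQtop.lt_top fun y _ => ?_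
        have := hline (Fin.cons 0 y) 0
        simp_rw [← hcons0] at this
        exact this
      · intro y hy
        have e1 : {k : ℤ | (Fin.cons (k : ℝ) y : Fin (n + 1) → ℝ) ∈ S} = ∅ :=
          Set.eq_empty_of_forall_notMem fun k hk => hy (hQbox _ _ hk)
        have e2 : {t : ℝ | (Fin.cons t y : Fin (n + 1) → ℝ) ∈ S} = ∅ :=
          Set.eq_empty_of_forall_notMem fun k hk => hy (hQbox _ _ hk)
        rw [e1, e2]; simp
    have hR' : ∀ i, 0 ≤ R' i := fun i => hR i.succ
    -- Slices inherit the line hypothesis, so induction applies to each of the at most `2 R 0 + 1`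
    -- integer slices.
    have hstep₂ : ∀ a : ℝ, |({k : Fin n → ℤ |
          (Fin.cons a (fun i => (k i : ℝ)) : Fin (n + 1) → ℝ) ∈ S}.ncard : ℝ)
        - volume.real {y : Fin n → ℝ | (Fin.cons a y : Fin (n + 1) → ℝ) ∈ S}|
        ≤ M * ∑ k, ∏ j ∈ univ.erase k, (2 * R' j + 1) := by
      intro a
      refine ih (hsl a) hR' ?_ ?_
      · intro y hy i
        simpa using hbox _ hy i.succ
      · intro y i
        have := hline (Fin.cons a y) i.succ
        simp_rw [← Fin.cons_update] at this
        exact this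
    -- The term `k = 0` absorbs the Fubini error; the other terms are the inductive error times the
    -- number of slices.
    have hsum : ∑ k, ∏ j ∈ univ.erase k, (2 * R j + 1) = ∏ i, (2 * R' i + 1) +
        (2 * R 0 + 1) * ∑ k, ∏ j ∈ univ.erase k, (2 * R' j + 1) := by
      have e0 : ∀ k : Fin (n + 1), ∏ j ∈ univ.erase k, (2 * R j + 1) =
          ∏ j, if j = k then 1 else (2 * R j + 1) := by
        intro k
        rw [← Finset.mul_prod_erase univ _ (mem_univ k)]
        simp only [if_true, one_mul]
        exact Finset.prod_congr rfl fun j hj => by rw [if_neg (Finset.ne_of_mem_erase hj)]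
      have e1 : ∀ k : Fin n, ∏ j ∈ univ.erase k, (2 * R' j + 1) =
          ∏ j, if j = k then 1 else (2 * R' j + 1) := by
        intro k
        rw [← Finset.mul_prod_erase univ _ (mem_univ k)]
        simp only [if_true, one_mul]
        exact Finset.prod_congr rfl fun j hj => by rw [if_neg (Finset.ne_of_mem_erase hj)]
      simp_rw [e0, e1]
      rw [Fin.sum_univ_succ, Finset.mul_sum]
      simp only [Fin.prod_univ_succ, if_true, one_mul, Fin.succ_ne_zero, if_false, Fin.succ_inj,
        (Fin.succ_ne_zero _).symm]
      rfl
    have hprod : ∏ i, (2 * R' i) ≤ ∏ i, (2 * R' i + 1) :=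
      Finset.prod_le_prod (fun i _ => by linarith [hR' i]) fun i _ => by linarith
    have hE : 0 ≤ M * ∑ k, ∏ j ∈ univ.erase k, (2 * R' j + 1) :=
      mul_nonneg hM (Finset.sum_nonneg fun k _ => Finset.prod_nonneg fun j _ => by
        linarith [hR' j])
    rw [ncard_int_succ hbox, hsum]
    push_cast
    calc _ ≤ |∑ a ∈ I, (({k : Fin n → ℤ |
            (Fin.cons (a : ℝ) (fun i => (k i : ℝ)) : Fin (n + 1) → ℝ) ∈ S}.ncard : ℝ)
          - volume.real {y : Fin n → ℝ | (Fin.cons (a : ℝ) y : Fin (n + 1) → ℝ) ∈ S})| +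
          |∑ a ∈ I, volume.real {y : Fin n → ℝ | (Fin.cons (a : ℝ) y : Fin (n + 1) → ℝ) ∈ S}
            - volume.real S| := by
          rw [Finset.sum_sub_distrib]; exact (abs_add_le _ _).trans' (le_of_eq (by congr 1; ring))
      _ ≤ (2 * R 0 + 1) * (M * ∑ k, ∏ j ∈ univ.erase k, (2 * R' j + 1)) +
          M * ∏ i, (2 * R' i) := by
        refine add_le_add ?_ hstep₁
        refine (Finset.abs_sum_le_sum_abs _ _).trans ?_
        refine (Finset.sum_le_card_nsmul _ _ _ fun a _ => hstep₂ (a : ℤ)).trans ?_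
        rw [nsmul_eq_mul]
        exact mul_le_mul_of_nonneg_right (card_int_Icc_le (hR 0)) hE
      _ ≤ _ := by
        have := mul_le_mul_of_nonneg_left hprod hM
        linarith

end UnitCircleLattice

/-! ### The Selberg integral over the cube, by Aomoto's method. -/

namespace UnitCircleLattice

open MeasureTheory Finset

/-- The absolute value of the Vandermonde determinant of `x`. -/
noncomputable def absVandermonde {n : ℕ} (x : Fin n → ℝ) : ℝ := |(Matrix.vandermonde x).det|

/-- Lebesgue measure on the cube `[-2, 2]ⁿ`. -/
noncomputable def cubeMeasure (n : ℕ) : Measure (Fin n → ℝ) :=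
  Measure.pi fun _ => volume.restrict (Set.Icc (-2 : ℝ) 2)

instance (n : ℕ) : IsFiniteMeasure (cubeMeasure n) := by
  unfold cubeMeasure; infer_instance

theorem cubeMeasure_eq (n : ℕ) :
    cubeMeasure n = volume.restrict (Set.univ.pi fun _ : Fin n => Set.Icc (-2 : ℝ) 2) := by
  rw [cubeMeasure, volume_pi, Measure.restrict_pi_pi]

theorem absVandermonde_nonneg {n : ℕ} (x : Fin n → ℝ) : 0 ≤ absVandermonde x := abs_nonneg _

theorem continuous_absVandermonde {n : ℕ} : Continuous (absVandermonde (n := n)) := by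
  unfold absVandermonde
  simp_rw [Matrix.det_vandermonde]
  fun_prop

theorem absVandermonde_comp_perm {n : ℕ} (σ : Equiv.Perm (Fin n)) (x : Fin n → ℝ) :
    absVandermonde (x ∘ σ) = absVandermonde x := by
  have : Matrix.vandermonde (x ∘ σ) = (Matrix.vandermonde x).submatrix σ id := by
    ext i j; simp [Matrix.vandermonde]
  rw [absVandermonde, this, Matrix.det_permute, abs_mul, absVandermonde]
  rcases Int.units_eq_one_or (Equiv.Perm.sign σ) with h | h <;> simp [h]

theorem absVandermonde_eq_zero {n : ℕ} {x : Fin n → ℝ} {i j : Fin n} (hij : i ≠ j)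
    (h : x i = x j) : absVandermonde x = 0 := by
  rw [absVandermonde, Matrix.det_vandermonde_eq_zero_iff.2 ⟨i, j, h, hij⟩, abs_zero]

theorem absVandermonde_cons {n : ℕ} (a : ℝ) (y : Fin n → ℝ) :
    absVandermonde (Fin.cons a y : Fin (n + 1) → ℝ) = (∏ j, |y j - a|) * absVandermonde y := by
  simp only [absVandermonde, Matrix.det_vandermonde]
  rw [Fin.prod_univ_succ, abs_mul]
  simp [Fin.prod_Ioi_succ, Finset.abs_prod]

theorem integrable_cubeMeasure_of_continuous {n : ℕ} {f : (Fin n → ℝ) → ℝ} (hf : Continuous f) :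
    Integrable f (cubeMeasure n) := by
  rw [cubeMeasure_eq]
  exact hf.continuousOn.integrableOn_compact (isCompact_univ_pi fun _ => isCompact_Icc)

theorem integral_cubeMeasure_comp_perm {n : ℕ} (σ : Equiv.Perm (Fin n)) (f : (Fin n → ℝ) → ℝ) :
    ∫ x, f (x ∘ σ) ∂cubeMeasure n = ∫ x, f x ∂cubeMeasure n := by
  have h := measurePreserving_piCongrLeft
    (fun _ : Fin n => (volume.restrict (Set.Icc (-2 : ℝ) 2) : Measure ℝ)) σ.symm
  have := h.integral_comp' f
  rw [cubeMeasure, ← this]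
  refine integral_congr_ae (Filter.Eventually.of_forall fun x => ?_)
  simp only
  congr 1
  funext i
  have := MeasurableEquiv.piCongrLeft_apply_apply (β := fun _ : Fin n => ℝ) σ.symm x (σ i)
  simpa using this.symm

/-- This is the logarithmic derivative; each factor contributes `(a - y j)⁻¹` whatever the sign
inside the absolute value. -/
theorem hasDerivAt_prod_abs_sub {n : ℕ} (y : Fin n → ℝ) {a : ℝ} (ha : ∀ j, y j ≠ a) :
    HasDerivAt (fun a => ∏ j, |y j - a|) ((∑ j, (a - y j)⁻¹) * ∏ j, |y j - a|) a := by
  have h : ∀ j ∈ (univ : Finset (Fin n)),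
      HasDerivAt (fun a => |y j - a|) ((a - y j)⁻¹ * |y j - a|) a := by
    intro j _
    have hne : y j - a ≠ 0 := sub_ne_zero.2 (ha j)
    have := (hasDerivAt_abs hne).comp a ((hasDerivAt_id a).const_sub (y j))
    refine this.congr_deriv ?_
    have h3 : (a - y j)⁻¹ = -(y j - a)⁻¹ := by rw [← inv_neg, neg_sub]
    rw [h3]
    rcases lt_or_gt_of_ne hne with h | h
    · rw [abs_of_neg h, sign_neg h]
      simp only [SignType.coe_neg, SignType.coe_one]
      field_simp
    · rw [abs_of_pos h, sign_pos h]
      simp only [SignType.coe_one]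
      field_simp
  have := HasDerivAt.fun_finsetProd h
  refine this.congr_deriv ?_
  rw [Finset.sum_mul]
  refine Finset.sum_congr rfl fun j hj => ?_
  rw [← Finset.mul_prod_erase univ _ hj, smul_eq_mul]
  ring

/-- The pole along `x 0 = x j.succ` is cancelled by a factor of the Vandermonde determinant, which
leaves a continuous dominating function. -/
theorem integrable_div_sub_mul_absVandermonde {n : ℕ} {P : (Fin (n + 1) → ℝ) → ℝ}
    (hP : Continuous P) (j : Fin n) :
    Integrable (fun x => P x * (x 0 - x j.succ)⁻¹ * absVandermonde x) (cubeMeasure (n + 1)) := by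
  have hG : Continuous fun x : Fin (n + 1) → ℝ =>
      |P x| * ((∏ i ∈ univ.erase j, |x i.succ - x 0|) * absVandermonde (Fin.tail x)) := by
    have h1 : Continuous fun x : Fin (n + 1) → ℝ => absVandermonde (Fin.tail x) :=
      continuous_absVandermonde.comp (by unfold Fin.tail; fun_prop)
    fun_prop
  refine (integrable_cubeMeasure_of_continuous hG).mono' ?_ (Filter.Eventually.of_forall fun x => ?_)
  · refine Measurable.aestronglyMeasurable ?_
    have := (continuous_absVandermonde (n := n + 1)).measurable
    have := hP.measurable
    fun_prop
  · have hx : absVandermonde x = (∏ i : Fin n, |x i.succ - x 0|) * absVandermonde (Fin.tail x) := by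
      conv_lhs => rw [← Fin.cons_self_tail x]
      rw [absVandermonde_cons]; rfl
    rw [Real.norm_eq_abs, abs_mul, abs_mul, abs_of_nonneg (absVandermonde_nonneg x), mul_assoc, hx]
    refine mul_le_mul_of_nonneg_left ?_ (abs_nonneg _)
    rw [← Finset.mul_prod_erase univ _ (mem_univ j), ← mul_assoc, ← mul_assoc, abs_inv,
      abs_sub_comm (x 0)]
    have h1 : |x j.succ - x 0|⁻¹ * |x j.succ - x 0| ≤ 1 := inv_mul_le_one
    calc _ = (|x j.succ - x 0|⁻¹ * |x j.succ - x 0|) *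
          ((∏ i ∈ univ.erase j, |x i.succ - x 0|) * absVandermonde (Fin.tail x)) := by ring
      _ ≤ 1 * _ := mul_le_mul_of_nonneg_right h1 (mul_nonneg (Finset.prod_nonneg fun _ _ =>
          abs_nonneg _) (absVandermonde_nonneg _))
      _ = _ := one_mul _

/-- Integration by parts in the first variable over the cube `[-2, 2]ⁿ⁺¹`, against the absolute
Vandermonde determinant. -/
theorem integral_deriv_mul_absVandermonde {n : ℕ} {f f' : ℝ → ℝ} (hf : ∀ a, HasDerivAt f (f' a) a)
    (hf' : Continuous f') {Q : (Fin n → ℝ) → ℝ} (hQ : Continuous Q) :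
    ∫ x : Fin (n + 1) → ℝ, (f' (x 0) * Q (Fin.tail x) * absVandermonde x +
        ∑ j : Fin n, f (x 0) * Q (Fin.tail x) * (x 0 - x j.succ)⁻¹ * absVandermonde x)
        ∂cubeMeasure (n + 1) =
      ∫ y : Fin n → ℝ, (f 2 * ∏ j, |y j - 2| - f (-2) * ∏ j, |y j + 2|) * Q y * absVandermonde y
        ∂cubeMeasure n := by
  have hfc : Continuous f := continuous_iff_continuousAt.2 fun a => (hf a).continuousAt
  have htail : Continuous fun x : Fin (n + 1) → ℝ => Q (Fin.tail x) :=
    hQ.comp (by unfold Fin.tail; fun_prop)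
  set G : (Fin (n + 1) → ℝ) → ℝ := fun x => f' (x 0) * Q (Fin.tail x) * absVandermonde x +
    ∑ j : Fin n, f (x 0) * Q (Fin.tail x) * (x 0 - x j.succ)⁻¹ * absVandermonde x with hG
  have hGint : Integrable G (cubeMeasure (n + 1)) := by
    refine Integrable.add (integrable_cubeMeasure_of_continuous ?_) (integrable_finsetSum _
      fun j _ => integrable_div_sub_mul_absVandermonde (by fun_prop) j)
    have := continuous_absVandermonde (n := n + 1)
    fun_prop
  have hmp := (measurePreserving_piFinSuccAbove
    (fun _ : Fin (n + 1) => (volume.restrict (Set.Icc (-2 : ℝ) 2) : Measure ℝ)) 0).symm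
  have hsymm : ∀ p : ℝ × (Fin n → ℝ),
      (MeasurableEquiv.piFinSuccAbove (fun _ : Fin (n + 1) => ℝ) 0).symm p = Fin.cons p.1 p.2 := by
    intro p
    simp [MeasurableEquiv.piFinSuccAbove, Fin.insertNthEquiv, Fin.insertNth_zero']
  have hGint' : Integrable (fun p : ℝ × (Fin n → ℝ) => G (Fin.cons p.1 p.2))
      ((volume.restrict (Set.Icc (-2 : ℝ) 2)).prod (cubeMeasure n)) := by
    have := (hmp.integrable_comp_emb (MeasurableEquiv.measurableEmbedding _)).2 hGint
    simp only [Function.comp_def, hsymm] at this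
    exact this
  have hstep : ∫ x, G x ∂cubeMeasure (n + 1) =
      ∫ p : ℝ × (Fin n → ℝ), G (Fin.cons p.1 p.2)
        ∂((volume.restrict (Set.Icc (-2 : ℝ) 2)).prod (cubeMeasure n)) := by
    have := hmp.integral_comp' G
    simp only [hsymm] at this
    exact this.symm
  rw [hstep, integral_prod_symm _ hGint']
  refine integral_congr_ae ?_
  filter_upwards [hGint'.prod_left_ae] with y hy
  have hcons : ∀ a : ℝ, G (Fin.cons a y) = (f' a * ∏ j, |y j - a| +
      f a * ((∑ j, (a - y j)⁻¹) * ∏ j, |y j - a|)) * (Q y * absVandermonde y) := by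
    intro a
    simp only [hG, Fin.cons_zero, Fin.cons_succ, Fin.tail_cons, absVandermonde_cons]
    rw [add_mul, Finset.sum_mul, Finset.mul_sum, Finset.sum_mul]
    congr 1
    · ring
    · exact Finset.sum_congr rfl fun j _ => by ring
  simp only [hcons] at hy ⊢
  -- The product of absolute values is continuous but may fail to be differentiable at the finitely
  -- many `y j`; the fundamental theorem of calculus tolerates a countable exceptional set.
  have hd : ∀ a ∈ Set.Ioo (-2 : ℝ) 2 \ Set.range y,
      HasDerivAt (fun a => (f a * ∏ j, |y j - a|) * (Q y * absVandermonde y))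
        ((f' a * ∏ j, |y j - a| + f a * ((∑ j, (a - y j)⁻¹) * ∏ j, |y j - a|))
          * (Q y * absVandermonde y)) a := fun a ha =>
    ((hf a).mul (hasDerivAt_prod_abs_sub y fun j h => ha.2 ⟨j, h⟩)).mul_const _
  have := integral_eq_of_hasDerivAt_off_countable_of_le _ _ (by norm_num : (-2 : ℝ) ≤ 2)
    (Set.finite_range y).countable (by fun_prop) hd (by
      rw [intervalIntegrable_iff_integrableOn_Icc_of_le (by norm_num)]; exact hy)
  rw [intervalIntegral.integral_of_le (by norm_num), ← integral_Icc_eq_integral_Ioc] at this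
  rw [this]
  simp only [sub_neg_eq_add]
  ring

/-- The moment `∫ ∏_{i ∈ s} (xᵢ + 2) |Δ(x)| dx` over the cube `[-2, 2]ⁿ`. -/
noncomputable def vandermondeMoment {n : ℕ} (s : Finset (Fin n)) : ℝ :=
  ∫ x, (∏ i ∈ s, (x i + 2)) * absVandermonde x ∂cubeMeasure n

theorem vandermondeMoment_map {n : ℕ} (σ : Equiv.Perm (Fin n)) (s : Finset (Fin n)) :
    vandermondeMoment (s.map σ.toEmbedding) = vandermondeMoment s := by
  rw [vandermondeMoment, vandermondeMoment, ← integral_cubeMeasure_comp_perm σ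
    fun x => (∏ i ∈ s, (x i + 2)) * absVandermonde x]
  simp [absVandermonde_comp_perm]

/-- Symmetrization: the integral does not change when coordinates are permuted. For a transposition
this turns the singular terms from integration by parts into polynomials. -/
theorem two_mul_integral_cubeMeasure {n : ℕ} (σ : Equiv.Perm (Fin n)) {F H : (Fin n → ℝ) → ℝ}
    (hF : Integrable F (cubeMeasure n)) (h : ∀ x, F x + F (x ∘ σ) = H x) :
    2 * ∫ x, F x ∂cubeMeasure n = ∫ x, H x ∂cubeMeasure n := by
  have hH : ∀ x, F (x ∘ σ) = H x - F x := fun x => by rw [← h x]; ring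
  have hint : Integrable (fun x => F (x ∘ σ)) (cubeMeasure n) := by
    have hmp := measurePreserving_piCongrLeft
      (fun _ : Fin n => (volume.restrict (Set.Icc (-2 : ℝ) 2) : Measure ℝ)) σ.symm
    refine ((hmp.integrable_comp_emb (MeasurableEquiv.measurableEmbedding _)).2 hF).congr
      (Filter.Eventually.of_forall fun x => ?_)
    simp only [Function.comp_def]
    congr 1
    funext i
    have := MeasurableEquiv.piCongrLeft_apply_apply (β := fun _ : Fin n => ℝ) σ.symm x (σ i)
    simpa using this
  rw [two_mul]
  nth_rw 2 [← integral_cubeMeasure_comp_perm σ]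
  rw [← integral_add hF hint]
  simp_rw [h]

/-- Aomoto's recursion: integrate by parts in `x 0` against `4 - x 0 ^ 2`, which kills both boundary
terms, and symmetrize each singular term under the swap of `0` and `j.succ`. -/
theorem vandermondeMoment_insert_zero {n : ℕ} (s : Finset (Fin n)) :
    (2 * n - #s + 4) * vandermondeMoment (insert 0 (s.map (Fin.succEmb n))) =
      4 * (n - #s + 2) * vandermondeMoment (s.map (Fin.succEmb n)) := by
  classical
  set K : (Fin (n + 1) → ℝ) → ℝ := fun x => ∏ i ∈ s, (x i.succ + 2) with hK
  have hKc : Continuous K := by fun_prop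
  have hΔc := continuous_absVandermonde (n := n + 1)
  have h0 : (0 : Fin (n + 1)) ∉ s.map (Fin.succEmb n) := by simp [Fin.succ_ne_zero]
  have hA : vandermondeMoment (s.map (Fin.succEmb n)) =
      ∫ x, K x * absVandermonde x ∂cubeMeasure (n + 1) := by
    simp [vandermondeMoment, hK, Finset.prod_map]
  have hB : vandermondeMoment (insert 0 (s.map (Fin.succEmb n))) =
      ∫ x, (x 0 + 2) * K x * absVandermonde x ∂cubeMeasure (n + 1) := by
    simp [vandermondeMoment, hK, Finset.prod_insert h0, Finset.prod_map]
  set A := vandermondeMoment (s.map (Fin.succEmb n))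
  set B := vandermondeMoment (insert 0 (s.map (Fin.succEmb n)))
  set F : Fin n → (Fin (n + 1) → ℝ) → ℝ := fun j x =>
    (4 - x 0 ^ 2) * K x * (x 0 - x j.succ)⁻¹ * absVandermonde x with hF
  have hFint : ∀ j, Integrable (F j) (cubeMeasure (n + 1)) := fun j =>
    integrable_div_sub_mul_absVandermonde (P := fun x => (4 - x 0 ^ 2) * K x) (by fun_prop) j
  have hbp : ∫ x, ((-2 * x 0) * K x * absVandermonde x + ∑ j, F j x) ∂cubeMeasure (n + 1) = 0 := by
    have := integral_deriv_mul_absVandermonde (n := n) (f := fun a => 4 - a ^ 2)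
      (f' := fun a => -2 * a) (fun a => by
        simpa using (hasDerivAt_pow 2 a).const_sub (4 : ℝ)) (by fun_prop)
      (Q := fun y => ∏ i ∈ s, (y i + 2)) (by fun_prop)
    rw [show (∫ y : Fin n → ℝ, ((4 - (2 : ℝ) ^ 2) * ∏ j, |y j - 2| - (4 - (-2 : ℝ) ^ 2)
      * ∏ j, |y j + 2|) * (∏ i ∈ s, (y i + 2)) * absVandermonde y ∂cubeMeasure n) = 0 by
        norm_num] at this
    exact this
  have hsw : ∀ (x : Fin (n + 1) → ℝ) (j : Fin n), (x ∘ Equiv.swap 0 j.succ) 0 = x j.succ ∧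
      (x ∘ Equiv.swap 0 j.succ) j.succ = x 0 ∧
      ∀ i, i ≠ j → (x ∘ Equiv.swap 0 j.succ) i.succ = x i.succ := by
    intro x j
    refine ⟨by simp, by simp, fun i hi => ?_⟩
    simp only [Function.comp]
    rw [Equiv.swap_apply_of_ne_of_ne (Fin.succ_ne_zero i) (by simpa using hi)]
  -- Here `((4 - u²)(w + 2) - (4 - w²)(u + 2)) / (u - w) = -(u + 2)(w + 2)`.
  have hmem : ∀ j ∈ s, 2 * ∫ x, F j x ∂cubeMeasure (n + 1) = -B := by
    intro j hj
    rw [hB, ← integral_neg]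
    refine two_mul_integral_cubeMeasure (Equiv.swap 0 j.succ) (hFint j) fun x => ?_
    obtain ⟨e1, e2, e3⟩ := hsw x j
    simp only [hF, hK, absVandermonde_comp_perm, ← Finset.mul_prod_erase s _ hj, e1, e2]
    have e4 : ∏ i ∈ s.erase j, ((x ∘ Equiv.swap 0 j.succ) i.succ + 2) =
        ∏ i ∈ s.erase j, (x i.succ + 2) :=
      Finset.prod_congr rfl fun i hi => by rw [e3 i (Finset.ne_of_mem_erase hi)]
    rw [e4]
    by_cases hx : x 0 = x j.succ
    · rw [absVandermonde_eq_zero (Fin.succ_ne_zero j).symm hx]; ring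
    · have h1 : x 0 - x j.succ ≠ 0 := sub_ne_zero.2 hx
      have h2 : (x j.succ - x 0)⁻¹ = -(x 0 - x j.succ)⁻¹ := by rw [← inv_neg, neg_sub]
      rw [h2]; field_simp; ring
  -- Here `((4 - u²) - (4 - w²)) / (u - w) = 4 - (u + 2) - (w + 2)`, and the last two terms have the
  -- same integral by symmetry.
  have hnot : ∀ j ∉ s, 2 * ∫ x, F j x ∂cubeMeasure (n + 1) = 4 * A - 2 * B := by
    intro j hj
    have hB' : B = ∫ x, (x j.succ + 2) * K x * absVandermonde x ∂cubeMeasure (n + 1) := by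
      rw [hB, ← integral_cubeMeasure_comp_perm (Equiv.swap 0 j.succ)]
      refine integral_congr_ae (Filter.Eventually.of_forall fun x => ?_)
      obtain ⟨e1, e2, e3⟩ := hsw x j
      simp only [hK, absVandermonde_comp_perm, e1]
      rw [Finset.prod_congr rfl fun i hi => by rw [e3 i (ne_of_mem_of_not_mem hi hj)]]
    have hAi : Integrable (fun x => 4 * (K x * absVandermonde x)) (cubeMeasure (n + 1)) :=
      integrable_cubeMeasure_of_continuous (by fun_prop)
    have hBi : Integrable (fun x => (x 0 + 2) * K x * absVandermonde x) (cubeMeasure (n + 1)) :=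
      integrable_cubeMeasure_of_continuous (by fun_prop)
    have hBi' : Integrable (fun x => (x j.succ + 2) * K x * absVandermonde x)
        (cubeMeasure (n + 1)) := integrable_cubeMeasure_of_continuous (by fun_prop)
    rw [two_mul B]
    nth_rw 1 [hB]
    rw [hB', hA, ← integral_const_mul (4 : ℝ), ← sub_sub, ← integral_sub hAi hBi,
      ← integral_sub (f := fun x =>
        4 * (K x * absVandermonde x) - (x 0 + 2) * K x * absVandermonde x) (hAi.sub hBi) hBi']
    refine two_mul_integral_cubeMeasure (Equiv.swap 0 j.succ) (hFint j) fun x => ?_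
    obtain ⟨e1, e2, e3⟩ := hsw x j
    simp only [hF, hK, absVandermonde_comp_perm, e1, e2]
    have e4 : ∏ i ∈ s, ((x ∘ Equiv.swap 0 j.succ) i.succ + 2) = ∏ i ∈ s, (x i.succ + 2) :=
      Finset.prod_congr rfl fun i hi => by rw [e3 i (ne_of_mem_of_not_mem hi hj)]
    rw [e4]
    by_cases hx : x 0 = x j.succ
    · rw [absVandermonde_eq_zero (Fin.succ_ne_zero j).symm hx]; ring
    · have h1 : x 0 - x j.succ ≠ 0 := sub_ne_zero.2 hx
      have h2 : (x j.succ - x 0)⁻¹ = -(x 0 - x j.succ)⁻¹ := by rw [← inv_neg, neg_sub]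
      rw [h2]; field_simp; ring
  have hfirst : ∫ x, (-2 * x 0) * K x * absVandermonde x ∂cubeMeasure (n + 1) = 4 * A - 2 * B := by
    rw [hA, hB, ← integral_const_mul, ← integral_const_mul, ← integral_sub]
    · refine integral_congr_ae (Filter.Eventually.of_forall fun x => ?_)
      simp only; ring
    all_goals exact integrable_cubeMeasure_of_continuous (by fun_prop)
  rw [integral_add (integrable_cubeMeasure_of_continuous (by fun_prop))
    (integrable_finsetSum _ fun j _ => hFint j), integral_finsetSum _ fun j _ => hFint j,
    hfirst] at hbp
  have hsum : 2 * ∑ j, ∫ x, F j x ∂cubeMeasure (n + 1) =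
      #s * (-B) + (n - #s) * (4 * A - 2 * B) := by
    rw [Finset.mul_sum, ← Finset.sum_add_sum_compl s, Finset.sum_congr rfl fun j hj => hmem j hj,
      Finset.sum_congr rfl fun j hj => hnot j (Finset.mem_compl.1 hj)]
    rw [Finset.sum_const, Finset.sum_const, nsmul_eq_mul, nsmul_eq_mul, Finset.card_compl,
      Nat.cast_sub (Finset.card_le_univ s), Fintype.card_fin]
  linarith

/-- A swap moves the new index to `0`; the coefficients are those of `vandermondeMoment_insert_zero`
with the dimension shifted by one. -/
theorem vandermondeMoment_insert {n : ℕ} {s : Finset (Fin n)} {a : Fin n} (ha : a ∉ s) :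
    (2 * n - #s + 2) * vandermondeMoment (insert a s) =
      4 * (n - #s + 1) * vandermondeMoment s := by
  classical
  obtain _ | n := n
  · exact a.elim0
  set t := s.map (Equiv.swap 0 a).toEmbedding with ht
  have h0 : (0 : Fin (n + 1)) ∉ t := by
    rw [ht, Finset.mem_map_equiv]; simpa using ha
  have hins : (insert a s).map (Equiv.swap 0 a).toEmbedding = insert 0 t := by
    rw [Finset.map_insert]; simp [ht]
  have hts : #t = #s := Finset.card_map _
  obtain ⟨u, hu⟩ : ∃ u : Finset (Fin n), u.map (Fin.succEmb n) = t := by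
    refine ⟨univ.filter fun i => i.succ ∈ t, ?_⟩
    ext i
    simp only [Finset.mem_map, Finset.mem_filter, Finset.mem_univ, true_and, Fin.coe_succEmb]
    constructor
    · rintro ⟨j, hj, rfl⟩; exact hj
    · intro hi
      obtain ⟨j, rfl⟩ := Fin.exists_succ_eq.2 (ne_of_mem_of_not_mem hi h0)
      exact ⟨j, hi, rfl⟩
  have hus : #u = #s := by rw [← hts, ← hu, Finset.card_map]
  have := vandermondeMoment_insert_zero u
  rw [hu, hus, ← hins, vandermondeMoment_map, ht, vandermondeMoment_map] at this
  push_cast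
  linarith

theorem vandermondeMoment_eq {n : ℕ} (s : Finset (Fin n)) :
    ((2 * n + 2).descFactorial #s : ℝ) * vandermondeMoment s =
      4 ^ #s * ((n + 1).descFactorial #s : ℝ) * vandermondeMoment (∅ : Finset (Fin n)) := by
  classical
  induction s using Finset.induction_on with
  | empty => simp
  | insert a s ha ih =>
    have hcard : #s ≤ n := by simpa using Finset.card_le_univ s
    rw [Finset.card_insert_of_notMem ha, Nat.descFactorial_succ, Nat.descFactorial_succ]
    rw [Nat.cast_mul, Nat.cast_mul, Nat.cast_sub (by lia), Nat.cast_sub (by lia)]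
    have h := vandermondeMoment_insert ha
    push_cast
    calc _ = ((2 * n + 2).descFactorial #s : ℝ) *
          ((2 * n - #s + 2) * vandermondeMoment (insert a s)) := by ring
      _ = 4 * (n - #s + 1) * (((2 * n + 2).descFactorial #s : ℝ) * vandermondeMoment s) := by
        rw [h]; ring
      _ = _ := by rw [ih]; ring

/-- Integrating by parts against `x 0 - 2` leaves only the boundary term at `-2`, which is the full
moment one dimension lower. Each singular term symmetrizes to half the integral. With
`vandermondeMoment_eq` for `univ` this gives a recursion in `n`. -/
theorem vandermondeMoment_empty_succ (n : ℕ) :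
    (n + 2) * vandermondeMoment (∅ : Finset (Fin (n + 1))) =
      8 * vandermondeMoment (univ : Finset (Fin n)) := by
  set A := vandermondeMoment (∅ : Finset (Fin (n + 1)))
  have hA : A = ∫ x, absVandermonde x ∂cubeMeasure (n + 1) := by simp [A, vandermondeMoment]
  have hΔc := continuous_absVandermonde (n := n + 1)
  set F : Fin n → (Fin (n + 1) → ℝ) → ℝ := fun j x =>
    (x 0 - 2) * 1 * (x 0 - x j.succ)⁻¹ * absVandermonde x with hF
  have hFint : ∀ j, Integrable (F j) (cubeMeasure (n + 1)) := fun j =>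
    integrable_div_sub_mul_absVandermonde (P := fun x => (x 0 - 2) * 1) (by fun_prop) j
  have hbp := integral_deriv_mul_absVandermonde (n := n) (f := fun a => a - 2)
      (f' := fun _ => 1) (fun a => (hasDerivAt_id a).sub_const 2) (by fun_prop)
      (Q := fun _ => 1) (by fun_prop)
  have hFj : ∀ j, 2 * ∫ x, F j x ∂cubeMeasure (n + 1) = A := by
    intro j
    rw [hA]
    refine two_mul_integral_cubeMeasure (Equiv.swap 0 j.succ) (hFint j) fun x => ?_
    simp only [hF, absVandermonde_comp_perm, Function.comp, Equiv.swap_apply_left,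
      Equiv.swap_apply_right]
    by_cases hx : x 0 = x j.succ
    · rw [absVandermonde_eq_zero (Fin.succ_ne_zero j).symm hx]; ring
    · have h1 : x 0 - x j.succ ≠ 0 := sub_ne_zero.2 hx
      have h2 : (x j.succ - x 0)⁻¹ = -(x 0 - x j.succ)⁻¹ := by rw [← inv_neg, neg_sub]
      rw [h2]; field_simp; ring
  rw [integral_add (integrable_cubeMeasure_of_continuous (by fun_prop))
    (integrable_finsetSum _ fun j _ => hFint j), integral_finsetSum _ fun j _ => hFint j] at hbp
  have hsum : 2 * ∑ j, ∫ x, F j x ∂cubeMeasure (n + 1) = n * A := by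
    rw [Finset.mul_sum, Finset.sum_congr rfl fun j _ => hFj j]
    simp
  have hR : ∫ y : Fin n → ℝ, (((2 : ℝ) - 2) * ∏ j, |y j - 2| - (-2 - 2) * ∏ j, |y j + 2|) * 1 *
      absVandermonde y ∂cubeMeasure n = 4 * vandermondeMoment (univ : Finset (Fin n)) := by
    rw [vandermondeMoment, ← integral_const_mul, cubeMeasure_eq]
    refine setIntegral_congr_fun (MeasurableSet.univ_pi fun _ => measurableSet_Icc) fun y hy => ?_
    rw [Finset.prod_congr (s₂ := univ) (f := fun j => |y j + 2|) (g := fun j => y j + 2) rfl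
      fun j _ => abs_of_nonneg (by linarith [(hy j (Set.mem_univ j)).1])]
    ring
  rw [hR] at hbp
  have h1 : ∫ x : Fin (n + 1) → ℝ, 1 * 1 * absVandermonde x ∂cubeMeasure (n + 1) = A := by
    rw [hA]; simp
  rw [h1] at hbp
  have : ∑ j, ∫ x, F j x ∂cubeMeasure (n + 1) = n * A / 2 := by linarith
  rw [this] at hbp
  linarith

theorem prod_Icc_two_mul_div (n : ℕ) :
    ∏ j ∈ Finset.Icc 1 n, (2 * (j : ℝ) / (2 * (j : ℝ) - 1)) =
      4 ^ n * (n.factorial : ℝ) ^ 2 / ((2 * n).factorial : ℝ) := by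
  induction n with
  | zero => simp
  | succ n ih =>
    rw [Finset.prod_Icc_succ_top (by lia), ih, show 2 * (n + 1) = 2 * n + 1 + 1 by ring,
      Nat.factorial_succ n, Nat.factorial_succ (2 * n + 1), Nat.factorial_succ (2 * n)]
    have h1 : (n.factorial : ℝ) ≠ 0 := by positivity
    have h2 : ((2 * n).factorial : ℝ) ≠ 0 := by positivity
    have h3 : (2 * ((n : ℝ) + 1) - 1) ≠ 0 := by
      have : (0 : ℝ) ≤ n := by positivity
      linarith
    push_cast
    field_simp
    ring

theorem v_succ (n : ℕ) : v (n + 1) = 2 / (n + 1) *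
    (4 ^ (n + 1) * ((n + 1).factorial : ℝ) ^ 2 / ((2 * (n + 1)).factorial : ℝ)) * v n := by
  rw [← prod_Icc_two_mul_div, v, v, Nat.factorial_succ, Finset.prod_Icc_succ_top (by lia),
    Finset.prod_Icc_succ_top (by lia)]
  have : ∏ j ∈ Finset.Icc 1 n, (2 * (j : ℝ) / (2 * (j : ℝ) - 1)) ^ (n + 1 + 1 - j) =
      (∏ j ∈ Finset.Icc 1 n, (2 * (j : ℝ) / (2 * (j : ℝ) - 1))) *
      ∏ j ∈ Finset.Icc 1 n, (2 * (j : ℝ) / (2 * (j : ℝ) - 1)) ^ (n + 1 - j) := by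
    rw [← Finset.prod_mul_distrib]
    refine Finset.prod_congr rfl fun j hj => ?_
    rw [← pow_succ']
    congr 1
    have := (Finset.mem_Icc.1 hj).2
    lia
  rw [this]
  have h1 : (n.factorial : ℝ) ≠ 0 := by positivity
  have h2 : (n : ℝ) + 1 ≠ 0 := by positivity
  have h3 : n + 1 + 1 - (n + 1) = 1 := by lia
  rw [h3, pow_one]
  push_cast
  field_simp
  ring

/-- A special case of Selberg's integral. -/
theorem integral_absVandermonde (n : ℕ) :
    ∫ x, absVandermonde x ∂cubeMeasure n = n.factorial * v n := by
  have hA : ∀ n, ∫ x, absVandermonde x ∂cubeMeasure n =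
    vandermondeMoment (∅ : Finset (Fin n)) := by intro n; simp [vandermondeMoment]
  rw [hA]
  induction n with
  | zero =>
    simp [vandermondeMoment, v, cubeMeasure, absVandermonde, Measure.real, Measure.pi_empty_univ]
  | succ n ih =>
    have h1 := vandermondeMoment_empty_succ n
    have h2 := vandermondeMoment_eq (univ : Finset (Fin n))
    rw [ih, Finset.card_univ, Fintype.card_fin] at h2
    have h3 := Nat.factorial_mul_descFactorial (show n ≤ 2 * n + 2 by lia)
    have h4 := Nat.factorial_mul_descFactorial (show n ≤ n + 1 by lia)
    rw [show 2 * n + 2 - n = n + 2 by lia, Nat.factorial_succ (n + 1)] at h3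
    rw [show n + 1 - n = 1 by lia, Nat.factorial_one, one_mul] at h4
    rw [h4] at h2
    have h3' : ((n : ℝ) + 2) * (n + 1).factorial * (2 * n + 2).descFactorial n =
        (2 * n + 2).factorial := by exact_mod_cast h3
    set D : ℝ := ((2 * n + 2).descFactorial n : ℝ)
    set E := vandermondeMoment (∅ : Finset (Fin (n + 1)))
    set U := vandermondeMoment (univ : Finset (Fin n))
    have hF : ((n + 1).factorial : ℝ) = (n + 1) * n.factorial := by
      rw [Nat.factorial_succ]; push_cast; ring
    have hn : (n.factorial : ℝ) ≠ 0 := by positivity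
    have hn1 : (n : ℝ) + 1 ≠ 0 := by positivity
    have hn2 : (n : ℝ) + 2 ≠ 0 := by positivity
    have hD : D ≠ 0 := by
      have : ((2 * n + 2).factorial : ℝ) ≠ 0 := by positivity
      rw [← h3'] at this
      exact right_ne_zero_of_mul this
    rw [v_succ, show 2 * (n + 1) = 2 * n + 2 by ring, ← h3', hF]
    have hU : U = 4 ^ n * ((n + 1) * n.factorial) * (n.factorial * v n) / D := by
      rw [eq_div_iff hD, ← hF]; linarith
    have hE : E = 8 * U / (n + 2) := by rw [eq_div_iff hn2]; linarith
    rw [hE, hU]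
    field_simp
    ring

end UnitCircleLattice

/-! ### Trace polynomials and `V n` as the image of a cube. -/

namespace UnitCircleLattice

open Polynomial

/-- The monic polynomial of degree `m` in `z + z⁻¹` equal to `z ^ m + z⁻¹ ^ m` (to `1` if `m = 0`). -/
noncomputable def chebBasis (m : ℕ) : ℝ[X] := if m = 0 then 1 else Chebyshev.C ℝ m

theorem chebyshevC_natDegree_monic (m : ℕ) :
    ((Chebyshev.C ℝ (m + 1 : ℕ)).natDegree = m + 1 ∧ (Chebyshev.C ℝ (m + 1 : ℕ)).Monic) := by
  induction m using Nat.strong_induction_on with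
  | _ m ih =>
    match m with
    | 0 => simp [monic_X]
    | 1 =>
      have : (Chebyshev.C ℝ (1 + 1 : ℕ)) = X ^ 2 - C 2 := by
        norm_num [Chebyshev.C_two]
        rfl
      rw [this]
      exact ⟨natDegree_X_pow_sub_C, monic_X_pow_sub_C _ (by norm_num)⟩
    | k + 2 =>
      obtain ⟨d1, m1⟩ := ih (k + 1) (by lia)
      obtain ⟨d0, m0⟩ := ih k (by lia)
      have e : (Chebyshev.C ℝ (k + 2 + 1 : ℕ)) =
          X * Chebyshev.C ℝ (k + 1 + 1 : ℕ) - Chebyshev.C ℝ (k + 1 : ℕ) := by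
        have := Chebyshev.C_add_two ℝ ((k + 1 : ℕ) : ℤ)
        push_cast at this ⊢
        convert this using 2
        ring
      have hX : (X * Chebyshev.C ℝ (k + 1 + 1 : ℕ)).Monic := monic_X.mul m1
      have hXd : (X * Chebyshev.C ℝ (k + 1 + 1 : ℕ)).natDegree = k + 2 + 1 := by
        rw [natDegree_X_mul m1.ne_zero, d1]
      rw [e]
      have hlt : (Chebyshev.C ℝ (k + 1 : ℕ)).degree < (X * Chebyshev.C ℝ (k + 1 + 1 : ℕ)).degree :=
        degree_lt_degree (by rw [d0, hXd]; lia)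
      exact ⟨by rw [natDegree_sub_eq_left_of_natDegree_lt (natDegree_lt_natDegree m0.ne_zero hlt),
        hXd], hX.sub_of_left hlt⟩

theorem chebBasis_natDegree (m : ℕ) : (chebBasis m).natDegree = m := by
  obtain _ | m := m
  · simp [chebBasis]
  · simpa [chebBasis] using (chebyshevC_natDegree_monic m).1

theorem chebBasis_monic (m : ℕ) : (chebBasis m).Monic := by
  obtain _ | m := m
  · simp [chebBasis]
  · simpa [chebBasis] using (chebyshevC_natDegree_monic m).2

theorem chebyshevC_eval_add_inv {z : ℂ} (hz : z ≠ 0) (m : ℕ) :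
    (Chebyshev.C ℂ m).eval (z + z⁻¹) = z ^ m + z⁻¹ ^ m := by
  induction m using Nat.twoStepInduction with
  | zero => norm_num
  | one => simp
  | more m h0 h1 =>
    have e : (Chebyshev.C ℂ (m + 2 : ℕ)) = X * Chebyshev.C ℂ (m + 1 : ℕ) - Chebyshev.C ℂ (m : ℕ) := by
      have := Chebyshev.C_add_two ℂ ((m : ℕ) : ℤ)
      push_cast at this ⊢
      exact this
    have hinv : z * z⁻¹ = 1 := mul_inv_cancel₀ hz
    rw [e, eval_sub, eval_mul, eval_X, h0, h1]
    linear_combination (z ^ m + z⁻¹ ^ m) * hinv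

theorem pow_mul_aeval_chebBasis {z : ℂ} (hz : z ≠ 0) {n m : ℕ} (hm : m ≠ 0) (hmn : m ≤ n) :
    z ^ n * aeval (z + z⁻¹) (chebBasis m) = z ^ (n + m) + z ^ (n - m) := by
  rw [chebBasis, if_neg hm, Chebyshev.aeval_C, chebyshevC_eval_add_inv hz, mul_add, ← pow_add,
    inv_pow, ← pow_sub₀ z hz hmn]

/-- Nonvanishing at `±2` makes a root there determine the moving coefficient on a coordinate line.
-/
theorem chebBasis_eval_two_ne_zero (m : ℕ) : (chebBasis m).eval 2 ≠ 0 := by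
  rw [chebBasis]; split_ifs <;> simp

theorem chebBasis_eval_neg_two_ne_zero (m : ℕ) : (chebBasis m).eval (-2) ≠ 0 := by
  rw [chebBasis]; split_ifs
  · simp
  · rw [Chebyshev.C_eval_neg_two]
    rcases Int.units_eq_one_or ((m : ℤ).negOnePow) with h | h <;> simp [h]

/-- A common zero of consecutive polynomials would descend through the three-term recurrence to `T 0
= 1`. -/
theorem chebyshevT_eval_ne_zero_or (y : ℝ) (m : ℕ) :
    (Chebyshev.T ℝ m).eval y ≠ 0 ∨ (Chebyshev.T ℝ (m + 1)).eval y ≠ 0 := by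
  induction m with
  | zero => simp
  | succ m ih =>
    by_contra! h
    have e := congrArg (eval y) (Chebyshev.T_add_two ℝ (m : ℤ))
    simp only [eval_sub, eval_mul, eval_X] at e
    have h1 : eval y (Chebyshev.T ℝ ((m : ℤ) + 1)) = 0 := by simpa using h.1
    have h2 : eval y (Chebyshev.T ℝ ((m : ℤ) + 2)) = 0 := by
      have := h.2; push_cast at this; rwa [add_assoc, one_add_one_eq_two] at this
    rw [h1, h2] at e
    rcases ih with h' | h'
    · apply h'; linarith
    · exact h' h1

/-- The formula for `(1 - X ^ 2) T'` in terms of consecutive `T` would turn a double root into a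
common zero of neighbours. -/
theorem chebBasis_derivative_eval_ne_zero {m : ℕ} {c : ℝ} (h : (chebBasis m).eval c = 0) :
    (derivative (chebBasis m)).eval c ≠ 0 := by
  obtain _ | m := m
  · simp [chebBasis] at h
  intro h'
  rw [chebBasis, if_neg (by lia), Chebyshev.C_eq_two_mul_T_comp_half_mul_X] at h h'
  have e := congrArg (eval (c / 2)) (Chebyshev.one_sub_X_sq_mul_derivative_T_eq_poly_in_T (R := ℝ) m)
  simp [derivative_comp] at h h' e
  have hc : (2 : ℝ)⁻¹ * c = c / 2 := by ring
  rw [hc] at h h'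
  rw [h, h'] at e
  have hm : (m : ℝ) + 1 ≠ 0 := by positivity
  rcases chebyshevT_eval_ne_zero_or (c / 2) m with h1 | h1
  · simp [hm, h1] at e
  · exact h1 h

/-- The polynomial `h` with `g_b(z) = zⁿ h(z + z⁻¹)`. -/
noncomputable def traceP {n : ℕ} (b : Fin n → ℝ) : ℝ[X] :=
  chebBasis n + ∑ i : Fin n, C (b i) * chebBasis (n - (i + 1))

theorem degree_sum_chebBasis_lt {n : ℕ} (b : Fin n → ℝ) :
    (∑ i : Fin n, C (b i) * chebBasis (n - (i + 1))).degree < n := by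
  refine (degree_sum_le _ _).trans_lt ?_
  refine (Finset.sup_lt_iff (WithBot.bot_lt_coe n)).2 fun i _ => ?_
  have hi := i.2
  refine (degree_le_natDegree.trans (Nat.cast_le.2 (natDegree_C_mul_le _ _))).trans_lt ?_
  rw [chebBasis_natDegree]
  exact Nat.cast_lt.2 (by lia)

theorem traceP_monic {n : ℕ} (b : Fin n → ℝ) : (traceP b).Monic := by
  refine (chebBasis_monic n).add_of_left ?_
  rw [degree_eq_natDegree (chebBasis_monic n).ne_zero, chebBasis_natDegree]
  exact degree_sum_chebBasis_lt b

theorem traceP_natDegree {n : ℕ} (b : Fin n → ℝ) : (traceP b).natDegree = n := by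
  refine natDegree_eq_of_degree_eq_some ?_
  have h : (chebBasis n).degree = n := by
    rw [degree_eq_natDegree (chebBasis_monic n).ne_zero, chebBasis_natDegree]
  rw [traceP, degree_add_eq_left_of_degree_lt, h]
  rw [h]; exact degree_sum_chebBasis_lt b

/-- Symmetric terms pair up as `z ^ (n + m) + z ^ (n - m)`. The middle term is unpaired, which is
why `chebBasis 0` is `1` and not `Chebyshev.C ℝ 0 = 2`. -/
theorem aeval_g {n : ℕ} (hn : n ≠ 0) (b : Fin n → ℝ) {z : ℂ} (hz : z ≠ 0) :
    aeval z (g b) = z ^ n * aeval (z + z⁻¹) (traceP b) := by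
  rw [g, traceP, map_add (aeval z), map_add (aeval (z + z⁻¹)), mul_add, pow_mul_aeval_chebBasis hz hn le_rfl, map_sum, map_sum,
    Finset.mul_sum]
  congr 1
  · simp [two_mul]
  refine Finset.sum_congr rfl fun i _ => ?_
  have hi := i.2
  split_ifs with h
  · rw [map_mul, map_mul, mul_left_comm, pow_mul_aeval_chebBasis hz (by lia) (by lia),
      show n + (n - ((i : ℕ) + 1)) = 2 * n - ((i : ℕ) + 1) by lia,
      show n - (n - ((i : ℕ) + 1)) = (i : ℕ) + 1 by lia]
    simp only [map_add, map_pow, aeval_X, aeval_C]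
  · rw [show n - ((i : ℕ) + 1) = 0 by lia, chebBasis, if_pos rfl, mul_one, mul_comm, map_mul,
      map_pow, aeval_X, aeval_C, aeval_C]

theorem g_coeff {n : ℕ} (b : Fin n → ℝ) (k : Fin n) : (g b).coeff (k + 1) = b k := by
  have hk := k.2
  rw [g, coeff_add, finsetSum_coeff, Finset.sum_eq_single k]
  · have h1 : (X ^ (2 * n) + 1 : ℝ[X]).coeff (k + 1) = 0 := by
      rw [coeff_add, coeff_X_pow, coeff_one, if_neg (by lia), if_neg (by lia), add_zero]
    rw [h1, zero_add]
    split_ifs with h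
    · rw [coeff_C_mul, coeff_add, coeff_X_pow, coeff_X_pow, if_neg (by lia), if_pos rfl]; simp
    · rw [coeff_C_mul, coeff_X_pow, if_pos (by lia), mul_one]
  · intro i _ hik
    have hi := i.2
    have hne : (i : ℕ) ≠ k := fun h => hik (Fin.ext h)
    split_ifs with h
    · rw [coeff_C_mul, coeff_add, coeff_X_pow, coeff_X_pow, if_neg (by lia), if_neg (by lia)]; simp
    · rw [coeff_C_mul, coeff_X_pow, if_neg (by lia), mul_zero]
  · simp

/-- The self-reciprocal polynomial `∏ (X² - xⱼ X + 1)`. -/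
noncomputable def reciprocalP {n : ℕ} (x : Fin n → ℝ) : ℝ[X] := ∏ j, (X ^ 2 - C (x j) * X + 1)

/-- The map from the traces `xⱼ = zⱼ + zⱼ⁻¹` to the coefficients of `∏ (X² - xⱼ X + 1)`. -/
noncomputable def coeffMap {n : ℕ} (x : Fin n → ℝ) : Fin n → ℝ :=
  fun i => (reciprocalP x).coeff (i + 1)

theorem aeval_reciprocalP {n : ℕ} (x : Fin n → ℝ) {z : ℂ} (hz : z ≠ 0) :
    aeval z (reciprocalP x) = z ^ n * aeval (z + z⁻¹) (∏ j, (X - C (x j))) := by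
  rw [reciprocalP, map_prod, map_prod]
  have : z ^ n = ∏ _j : Fin n, z := by simp
  rw [this, ← Finset.prod_mul_distrib]
  refine Finset.prod_congr rfl fun j _ => ?_
  simp
  field_simp
  ring

theorem g_eq_reciprocalP {n : ℕ} (hn : n ≠ 0) {b x : Fin n → ℝ}
    (h : traceP b = ∏ j, (X - C (x j))) : g b = reciprocalP x := by
  apply map_injective (algebraMap ℝ ℂ) (algebraMap ℝ ℂ).injective
  refine eq_of_infinite_eval_eq _ _ (Set.Infinite.mono (s := {0}ᶜ) (fun z hz => ?_)
    (Set.finite_singleton 0).infinite_compl)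
  have hz : z ≠ 0 := hz
  simp only [Set.mem_ofPred_eq, eval_map_algebraMap]
  rw [aeval_g hn b hz, aeval_reciprocalP x hz, h]

theorem exists_eq_sum_chebBasis (n : ℕ) {P : ℝ[X]} (hP : P.degree < n) :
    ∃ c : ℕ → ℝ, P = ∑ k ∈ Finset.range n, C (c k) * chebBasis k := by
  induction n generalizing P with
  | zero => exact ⟨0, by simpa using hP⟩
  | succ n ih =>
    have hd : (P - C (P.coeff n) * chebBasis n).degree < n := by
      rw [degree_lt_iff_coeff_zero] at hP ⊢
      intro k hk
      rcases hk.eq_or_lt with rfl | hk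
      · have := (chebBasis_monic n).coeff_natDegree
        rw [chebBasis_natDegree] at this
        simp [this]
      · rw [coeff_sub, hP k hk, coeff_C_mul, coeff_eq_zero_of_natDegree_lt (p := chebBasis n)
          (by rwa [chebBasis_natDegree])]
        simp
    obtain ⟨c, hc⟩ := ih hd
    refine ⟨Function.update c n (P.coeff n), ?_⟩
    rw [Finset.sum_range_succ, Function.update_self]
    rw [Finset.sum_congr rfl fun k hk => by
      rw [Function.update_of_ne (Finset.mem_range.1 hk).ne], ← hc]
    ring

theorem exists_traceP_eq {n : ℕ} {P : ℝ[X]} (hP : P.Monic) (hd : P.natDegree = n) :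
    ∃ b : Fin n → ℝ, traceP b = P := by
  have hlt : (P - chebBasis n).degree < n := by
    have h1 : P.degree = n := by rw [degree_eq_natDegree hP.ne_zero, hd]
    have h2 : (chebBasis n).degree = n := by
      rw [degree_eq_natDegree (chebBasis_monic n).ne_zero, chebBasis_natDegree]
    rw [← h1]
    exact degree_sub_lt_left (by rw [h1, h2]) hP.ne_zero
      (by rw [hP.leadingCoeff, (chebBasis_monic n).leadingCoeff])
  obtain ⟨c, hc⟩ := exists_eq_sum_chebBasis n hlt
  refine ⟨fun i => c (n - (i + 1)), ?_⟩
  rw [traceP, Fin.sum_univ_eq_sum_range fun i => C (c (n - (i + 1))) * chebBasis (n - (i + 1))]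
  have := Finset.sum_range_reflect (fun k => C (c k) * chebBasis k) n
  simp only [Nat.sub_sub, Nat.add_comm 1] at this
  rw [this, ← hc]
  ring

theorem coeffMap_eq_of_traceP_eq {n : ℕ} (hn : n ≠ 0) {b x : Fin n → ℝ}
    (h : traceP b = ∏ j, (X - C (x j))) : coeffMap x = b := by
  funext i
  rw [coeffMap, ← g_eq_reciprocalP hn h, g_coeff]

/-- The `chebBasis` polynomials are monic of every degree, so some `b` realizes the product;
comparing coefficients of `g b` identifies it as `coeffMap x`. -/
theorem traceP_coeffMap {n : ℕ} (hn : n ≠ 0) (x : Fin n → ℝ) :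
    traceP (coeffMap x) = ∏ j, (X - C (x j)) := by
  obtain ⟨b, hb⟩ := exists_traceP_eq (n := n) (P := ∏ j, (X - C (x j)))
    (monic_prod_of_monic _ _ fun j _ => monic_X_sub_C _) (by simp)
  rw [coeffMap_eq_of_traceP_eq hn hb, hb]

/-- The quadratic `z ^ 2 - x z + 1` has nonpositive discriminant: `z` is either a double root `±1`
or one of two conjugate roots with product `1`. -/
theorem norm_eq_one_of_add_inv_eq {z : ℂ} (hz : z ≠ 0) {x : ℝ} (hx : |x| ≤ 2)
    (h : z + z⁻¹ = x) : ‖z‖ = 1 := by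
  have hq : z ^ 2 - x * z + 1 = 0 := by
    rw [← h]; field_simp; ring
  have hre := congrArg Complex.re hq
  have him := congrArg Complex.im hq
  simp [pow_two] at hre him
  have hx2 : x ^ 2 ≤ 4 := by nlinarith [abs_le.1 hx]
  have hn : Complex.normSq z = 1 := by
    rw [Complex.normSq_apply]
    by_cases hb : z.im = 0
    · rw [hb] at hre ⊢
      have h1 : z.re = x / 2 := by nlinarith [sq_nonneg (z.re - x / 2)]
      nlinarith
    · have h1 : x = 2 * z.re := by
        apply mul_right_cancel₀ hb; linarith
      rw [h1] at hre
      linarith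
  rw [← Real.sqrt_one, ← hn]; rfl

theorem exists_add_inv_eq (w : ℂ) : ∃ z : ℂ, z ≠ 0 ∧ z + z⁻¹ = w := by
  obtain ⟨s, hs⟩ := IsAlgClosed.exists_pow_nat_eq (w ^ 2 - 4) (n := 2) (by norm_num)
  have hmul : (w + s) / 2 * ((w - s) / 2) = 1 := by linear_combination (-1 / 4 : ℂ) * hs
  refine ⟨(w + s) / 2, left_ne_zero_of_mul_eq_one hmul, ?_⟩
  rw [inv_eq_of_mul_eq_one_right hmul]
  ring

theorem exists_real_of_norm_eq_one {z : ℂ} (hz : ‖z‖ = 1) :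
    ∃ x ∈ Set.Icc (-2 : ℝ) 2, (x : ℂ) = z + z⁻¹ := by
  refine ⟨2 * z.re, ?_, ?_⟩
  · have := abs_le.1 ((Complex.abs_re_le_norm z).trans_eq hz)
    constructor <;> linarith
  · rw [Complex.inv_eq_conj hz, Complex.add_conj]

theorem exists_eq_prod_X_sub_C {P : ℝ[X]} (hP : P.Monic) {n : ℕ} (hd : P.natDegree = n)
    (hs : P.Splits) : ∃ x : Fin n → ℝ, P = ∏ j, (X - C (x j)) := by
  have hcard : P.roots.toList.length = n := by
    rw [Multiset.length_toList, ← hs.natDegree_eq_card_roots, hd]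
  subst hcard
  refine ⟨fun j => P.roots.toList.get j, ?_⟩
  have h := hs.eq_prod_roots_of_monic hP
  conv_lhs => rw [h, ← Multiset.coe_toList P.roots]
  rw [Multiset.map_coe, Multiset.prod_coe, ← List.prod_ofFn]
  congr 1
  apply List.ext_get <;> simp

theorem ne_zero_of_aeval_g_eq_zero {n : ℕ} (hn : n ≠ 0) (b : Fin n → ℝ) {z : ℂ} (h : aeval z (g b) = 0) :
    z ≠ 0 := by
  rintro rfl
  rw [g, map_add, map_sum, Finset.sum_eq_zero] at h
  · simp [hn] at h
  · intro i _
    have := i.2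
    split_ifs with hi
    · simp; right; lia
    · simp [hn]

/-- Every complex `w` is some `z + z⁻¹`, so for `b` in `V n` all roots of `traceP b` lie in `[-2,
2]`, and `traceP b` splits over the reals. The converse is `norm_eq_one_of_add_inv_eq`. -/
theorem V_eq_image {n : ℕ} (hn : n ≠ 0) :
    V n = coeffMap '' (Set.univ.pi fun _ : Fin n => Set.Icc (-2 : ℝ) 2) := by
  ext b
  constructor
  · intro hb
    have hroot : ∀ w : ℂ, aeval w (traceP b) = 0 → ∃ x ∈ Set.Icc (-2 : ℝ) 2, (x : ℂ) = w := by
      intro w hw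
      obtain ⟨z, hz, rfl⟩ := exists_add_inv_eq w
      exact exists_real_of_norm_eq_one (hb z (by rw [aeval_g hn b hz, hw, mul_zero]))
    have hs : (traceP b).Splits := by
      refine Splits.of_splits_map (algebraMap ℝ ℂ)
        (IsAlgClosed.splits _) fun w hw => ?_
      rw [mem_roots_map (traceP_monic b).ne_zero] at hw
      obtain ⟨x, _, rfl⟩ := hroot w hw
      exact ⟨x, rfl⟩
    obtain ⟨x, hx⟩ := exists_eq_prod_X_sub_C (traceP_monic b) (traceP_natDegree b) hs
    refine ⟨x, fun j _ => ?_, coeffMap_eq_of_traceP_eq hn hx⟩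
    obtain ⟨y, hy, hyx⟩ := hroot (x j) (by
      rw [hx, map_prod]
      exact Finset.prod_eq_zero (Finset.mem_univ j) (by simp))
    rw [Complex.ofReal_inj] at hyx
    exact hyx ▸ hy
  · rintro ⟨x, hx, rfl⟩ z hz
    have hz0 := ne_zero_of_aeval_g_eq_zero hn _ hz
    rw [aeval_g hn _ hz0, traceP_coeffMap hn, map_prod, mul_eq_zero] at hz
    obtain ⟨j, _, hj⟩ := Finset.prod_eq_zero_iff.1 (hz.resolve_left (pow_ne_zero n hz0))
    have hj' : z + z⁻¹ = x j := by simpa [sub_eq_zero] using hj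
    exact norm_eq_one_of_add_inv_eq hz0 (abs_le.2 (hx j (Set.mem_univ j))) hj'

theorem contDiff_reciprocalP_coeff {n : ℕ} (k : ℕ) :
    ContDiff ℝ 1 fun x : Fin n → ℝ => (reciprocalP x).coeff k := by
  classical
  have : ∀ (s : Finset (Fin n)) (k : ℕ), ContDiff ℝ 1 fun x : Fin n → ℝ =>
      (∏ j ∈ s, (X ^ 2 - C (x j) * X + 1 : ℝ[X])).coeff k := by
    intro s
    induction s using Finset.induction_on with
    | empty => intro k; simpa using contDiff_const
    | insert a s ha ih =>
      intro k
      simp_rw [Finset.prod_insert ha, coeff_mul]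
      refine ContDiff.sum fun p _ => ContDiff.mul ?_ (ih _)
      simp only [coeff_add, coeff_sub, coeff_C_mul]
      fun_prop
  exact this Finset.univ k

theorem contDiff_coeffMap {n : ℕ} : ContDiff ℝ 1 (coeffMap (n := n)) :=
  contDiff_pi.2 fun _ => contDiff_reciprocalP_coeff _

theorem isCompact_V {n : ℕ} (hn : n ≠ 0) : IsCompact (V n) := by
  rw [V_eq_image hn]
  exact (isCompact_univ_pi fun _ => isCompact_Icc).image contDiff_coeffMap.continuous

theorem g_monic_natDegree {n : ℕ} (hn : n ≠ 0) (b : Fin n → ℝ) :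
    (g b).Monic ∧ (g b).natDegree = 2 * n := by
  have hlt : (1 + ∑ i : Fin n, if (i : ℕ) + 1 < n then
      C (b i) * (X ^ (2 * n - ((i : ℕ) + 1)) + X ^ ((i : ℕ) + 1)) else C (b i) * X ^ n : ℝ[X]).degree
        < (2 * n : ℕ) := by
    rw [degree_lt_iff_coeff_zero]
    intro k hk
    rw [coeff_add, coeff_one, if_neg (by lia), zero_add, finsetSum_coeff]
    refine Finset.sum_eq_zero fun i _ => ?_
    have := i.2
    split_ifs with h
    · rw [coeff_C_mul, coeff_add, coeff_X_pow, coeff_X_pow, if_neg (by lia), if_neg (by lia)]; simp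
    · rw [coeff_C_mul, coeff_X_pow, if_neg (by lia), mul_zero]
  rw [g, add_assoc]
  refine ⟨monic_X_pow_add hlt, natDegree_eq_of_degree_eq_some ?_⟩
  rw [degree_add_eq_left_of_degree_lt] <;> rw [degree_X_pow]
  exact hlt

/-- Up to sign, coefficients are elementary symmetric functions of `2 n` roots of modulus `1`. -/
theorem abs_le_choose_of_mem_V {n : ℕ} (hn : n ≠ 0) {b : Fin n → ℝ} (hb : b ∈ V n) (i : Fin n) :
    |b i| ≤ ((2 * n).choose (i + 1) : ℝ) := by
  obtain ⟨hm, hd⟩ := g_monic_natDegree hn b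
  have := coeff_le_of_roots_le (p := g b) (f := algebraMap ℝ ℂ) (B := 1) (i + 1) hm
    (IsAlgClosed.splits _) fun z hz => by
      rw [mem_roots_map hm.ne_zero] at hz
      exact (hb z hz).le
  rw [coeff_map, g_coeff, hd, one_pow, one_mul] at this
  simpa using this

end UnitCircleLattice

/-! ### The Jacobian of `coeffMap` and frontier points on coordinate lines. -/

namespace UnitCircleLattice

open Polynomial MeasureTheory Topology

theorem traceP_eval {n : ℕ} (b : Fin n → ℝ) (c : ℝ) :
    (traceP b).eval c = (chebBasis n).eval c + ∑ i : Fin n, b i * (chebBasis (n - (i + 1))).eval c := by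
  simp [traceP, eval_finsetSum]

theorem hasStrictFDerivAt_coeffMap {n : ℕ} (x : Fin n → ℝ) :
    HasStrictFDerivAt coeffMap (fderiv ℝ coeffMap x) x :=
  contDiff_coeffMap.contDiffAt.hasStrictFDerivAt (by norm_num)

/-- Differentiate `(traceP (coeffMap x)).eval c = ∏ (c - x l)` in the variable `x j`, in which it is
affine. -/
theorem sum_fderiv_coeffMap {n : ℕ} (hn : n ≠ 0) (x : Fin n → ℝ) (j : Fin n) (c : ℝ) :
    ∑ i : Fin n, fderiv ℝ coeffMap x (Pi.single j 1) i * (chebBasis (n - (i + 1))).eval c =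
      -∏ l ∈ Finset.univ.erase j, (c - x l) := by
  have hline : HasDerivAt (fun s : ℝ => x + s • (Pi.single j 1 : Fin n → ℝ)) (Pi.single j 1) 0 := by
    simpa using ((hasDerivAt_id (0 : ℝ)).smul_const (Pi.single j 1 : Fin n → ℝ)).const_add x
  have h1 : HasDerivAt (fun s : ℝ => coeffMap (x + s • (Pi.single j 1 : Fin n → ℝ)))
      (fderiv ℝ coeffMap x (Pi.single j 1)) 0 := by
    have hf : HasFDerivAt coeffMap (fderiv ℝ coeffMap x)
        (x + (0 : ℝ) • (Pi.single j 1 : Fin n → ℝ)) := by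
      simpa using (hasStrictFDerivAt_coeffMap x).hasFDerivAt
    exact hf.comp_hasDerivAt (0 : ℝ) hline
  have h2 : HasDerivAt (fun s : ℝ => (chebBasis n).eval c + ∑ i : Fin n,
      coeffMap (x + s • (Pi.single j 1 : Fin n → ℝ)) i * (chebBasis (n - (i + 1))).eval c)
      (∑ i : Fin n, fderiv ℝ coeffMap x (Pi.single j 1) i * (chebBasis (n - (i + 1))).eval c) 0 :=
    (HasDerivAt.fun_sum fun i _ => (hasDerivAt_pi.1 h1 i).mul_const _).const_add _
  have h3 : (fun s : ℝ => (chebBasis n).eval c + ∑ i : Fin n,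
      coeffMap (x + s • (Pi.single j 1 : Fin n → ℝ)) i * (chebBasis (n - (i + 1))).eval c) =
      fun s => (c - x j - s) * ∏ l ∈ Finset.univ.erase j, (c - x l) := by
    funext s
    rw [← traceP_eval, traceP_coeffMap hn, eval_prod, ← Finset.mul_prod_erase _ _ (Finset.mem_univ j)]
    congr 1
    · simp; ring
    · refine Finset.prod_congr rfl fun l hl => ?_
      simp [Finset.ne_of_mem_erase hl]
  rw [h3] at h2
  have h4 : HasDerivAt (fun s : ℝ => (c - x j - s) * ∏ l ∈ Finset.univ.erase j, (c - x l))
      (-∏ l ∈ Finset.univ.erase j, (c - x l)) 0 := by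
    simpa using ((hasDerivAt_id (0 : ℝ)).const_sub (c - x j)).mul_const
      (∏ l ∈ Finset.univ.erase j, (c - x l))
  exact h2.unique h4

theorem prod_prod_erase_abs_sub {n : ℕ} (x : Fin n → ℝ) :
    ∏ k, ∏ l ∈ Finset.univ.erase k, |x k - x l| = absVandermonde x ^ 2 := by
  have e0 : ∀ {n : ℕ} (x : Fin n → ℝ) (k : Fin n), ∏ l ∈ Finset.univ.erase k, |x k - x l| =
      ∏ l, if l = k then 1 else |x k - x l| := by
    intro n x k
    rw [← Finset.mul_prod_erase Finset.univ _ (Finset.mem_univ k)]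
    simp only [if_true, one_mul]
    exact Finset.prod_congr rfl fun j hj => by rw [if_neg (Finset.ne_of_mem_erase hj)]
  simp_rw [e0]
  induction n with
  | zero => simp [absVandermonde]
  | succ n ih =>
    have hx : absVandermonde x = (∏ i : Fin n, |x i.succ - x 0|) * absVandermonde (Fin.tail x) := by
      conv_lhs => rw [← Fin.cons_self_tail x]
      rw [absVandermonde_cons]; rfl
    rw [hx, mul_pow, ← ih (Fin.tail x), Fin.prod_univ_succ]
    simp only [Fin.prod_univ_succ, if_true, one_mul, Fin.succ_ne_zero, if_false, Fin.succ_inj,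
        (Fin.succ_ne_zero _).symm, Finset.prod_mul_distrib, Fin.tail, pow_two]
    rw [Finset.prod_congr rfl fun i _ => abs_sub_comm (x 0) (x i.succ), mul_assoc]

/-- Monic polynomials of degrees `0, …, n - 1` give the Vandermonde determinant; the reversed order
of columns only affects the sign. -/
theorem abs_det_chebBasis {n : ℕ} (x : Fin n → ℝ) :
    |(Matrix.of fun k i : Fin n => (chebBasis (n - (i + 1))).eval (x k)).det| =
      absVandermonde x := by
  rw [absVandermonde, Matrix.det_eval_matrixOfPolynomials_eq_det_vandermonde x
    (fun i : Fin n => chebBasis i) (fun i => chebBasis_natDegree i) fun i => chebBasis_monic i]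
  have : (Matrix.of fun k i : Fin n => (chebBasis (n - (i + 1))).eval (x k)) =
      (Matrix.of fun i j : Fin n => (chebBasis j).eval (x i)).submatrix id Fin.revPerm := by
    ext k i; simp [Fin.val_rev]
  rw [this, Matrix.det_permute', abs_mul]
  rcases Int.units_eq_one_or (Equiv.Perm.sign (Fin.revPerm (n := n))) with h | h <;> simp [h]

/-- Taking `c = x k` in `sum_fderiv_coeffMap`, the evaluation matrix times the Jacobian is diagonal.
In absolute value its determinant is the square of the Vandermonde determinant, one factor of which
cancels. -/
theorem abs_det_fderiv_coeffMap {n : ℕ} (hn : n ≠ 0) {x : Fin n → ℝ} (hx : Function.Injective x) :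
    |(fderiv ℝ coeffMap x).det| = absVandermonde x := by
  set J := LinearMap.toMatrix' (fderiv ℝ coeffMap x : (Fin n → ℝ) →ₗ[ℝ] (Fin n → ℝ)) with hJ
  have hdet : (fderiv ℝ coeffMap x).det = J.det := by
    rw [hJ, LinearMap.det_toMatrix', ContinuousLinearMap.det]
  have hmul : (Matrix.of fun k i : Fin n => (chebBasis (n - (i + 1))).eval (x k)) * J =
      Matrix.diagonal fun k => -∏ l ∈ Finset.univ.erase k, (x k - x l) := by
    ext k j
    rw [Matrix.mul_apply]
    have := sum_fderiv_coeffMap hn x j (x k)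
    simp only [hJ, LinearMap.toMatrix'_apply, Matrix.of_apply, Matrix.diagonal_apply]
    simp only [ContinuousLinearMap.coe_coe]
    rw [Finset.sum_congr rfl fun i _ => mul_comm _ _, this]
    split_ifs with hkj
    · rw [hkj]
    · rw [Finset.prod_eq_zero (Finset.mem_erase.2 ⟨hkj, Finset.mem_univ k⟩) (sub_self _), neg_zero]
  have hne : absVandermonde x ≠ 0 := by
    rw [absVandermonde, abs_ne_zero]
    exact Matrix.det_vandermonde_ne_zero_iff.2 hx
  have h := congrArg (fun M => |Matrix.det M|) hmul
  simp only [Matrix.det_mul, Matrix.det_diagonal, abs_mul, Finset.abs_prod, abs_neg,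
    abs_det_chebBasis] at h
  rw [prod_prod_erase_abs_sub, pow_two, ← hdet] at h
  exact mul_left_cancel₀ hne h

/-- The Jacobian is nonzero there, so the inverse function theorem makes `coeffMap` locally open. -/
theorem coeffMap_mem_interior_V {n : ℕ} (hn : n ≠ 0) {x : Fin n → ℝ} (hx : Function.Injective x)
    (hx' : ∀ j, x j ∈ Set.Ioo (-2 : ℝ) 2) : coeffMap x ∈ interior (V n) := by
  have hdet : (fderiv ℝ coeffMap x).det ≠ 0 := by
    rw [← abs_ne_zero, abs_det_fderiv_coeffMap hn hx, absVandermonde, abs_ne_zero]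
    exact Matrix.det_vandermonde_ne_zero_iff.2 hx
  set e := (fderiv ℝ coeffMap x).toContinuousLinearEquivOfDetNeZero hdet
  have hs : HasStrictFDerivAt coeffMap (e : (Fin n → ℝ) →L[ℝ] (Fin n → ℝ)) x := by
    simpa [e] using hasStrictFDerivAt_coeffMap x
  rw [mem_interior_iff_mem_nhds, ← hs.map_nhds_eq_of_equiv, Filter.mem_map, V_eq_image hn]
  have : (Set.univ.pi fun _ : Fin n => Set.Ioo (-2 : ℝ) 2) ∈ 𝓝 x :=
    (isOpen_set_pi Set.finite_univ fun _ _ => isOpen_Ioo).mem_nhds fun j _ => hx' j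
  filter_upwards [this] with y hy
  exact ⟨y, fun j _ => Set.Ioo_subset_Icc_self (hy j (Set.mem_univ j)), rfl⟩

theorem traceP_update {n : ℕ} (b : Fin n → ℝ) (i : Fin n) (t : ℝ) :
    traceP (Function.update b i t) =
      traceP (Function.update b i 0) + C t * chebBasis (n - (i + 1)) := by
  have h : ∀ s : ℝ, ∑ k : Fin n, C (Function.update b i s k) * chebBasis (n - (k + 1)) =
      C s * chebBasis (n - (i + 1)) +
        ∑ k ∈ Finset.univ.erase i, C (b k) * chebBasis (n - (k + 1)) := by
    intro s
    rw [← Finset.add_sum_erase _ _ (Finset.mem_univ i), Function.update_self]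
    congr 1
    exact Finset.sum_congr rfl fun k hk => by
      rw [Function.update_of_ne (Finset.ne_of_mem_erase hk)]
  rw [traceP, traceP, h, h, C_0]
  ring

/-- The Wronskian of `h` and `T`, monic of different degrees, does not vanish. -/
theorem wronskian_ne_zero_of_monic {h T : ℝ[X]} (hh : h.Monic) (hT : T.Monic)
    (hd : T.natDegree < h.natDegree) :
    derivative h * T - h * derivative T ≠ 0 ∧
      (derivative h * T - h * derivative T).natDegree ≤ h.natDegree + T.natDegree - 1 := by
  set n := h.natDegree with hn
  set m := T.natDegree with hm
  have hn1 : n - 1 + 1 = n := by lia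
  have hdh : (derivative h).natDegree ≤ n - 1 := natDegree_derivative_le h
  have hdT : (derivative T).natDegree ≤ m - 1 := natDegree_derivative_le T
  have hc : (derivative h).coeff (n - 1) = n := by
    rw [coeff_derivative, hn1, hn, hh.coeff_natDegree, one_mul]
    exact_mod_cast hn1
  -- In degree `n + m - 1` the Wronskian has coefficient `n - m`, which is nonzero.
  have h1 : (derivative h * T).coeff (n - 1 + m) = n := by
    rw [coeff_mul_add_eq_of_natDegree_le hdh le_rfl, hc, hT.coeff_natDegree, mul_one]
  have h2 : (h * derivative T).coeff (n - 1 + m) = m := by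
    rcases Nat.eq_zero_or_pos m with h0 | h0
    · rw [derivative_of_natDegree_zero h0, h0]; simp
    · have hm1 : m - 1 + 1 = m := by lia
      rw [show n - 1 + m = n + (m - 1) by lia, coeff_mul_add_eq_of_natDegree_le le_rfl hdT,
        hh.coeff_natDegree, one_mul, coeff_derivative, hm1, hm, hT.coeff_natDegree, one_mul]
      exact_mod_cast hm1
  constructor
  · intro h0
    have := congrArg (fun P => P.coeff (n - 1 + m)) h0
    simp only [coeff_sub, h1, h2, coeff_zero] at this
    have hlt : (m : ℝ) < n := by exact_mod_cast hd
    linarith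
  · refine (natDegree_sub_le _ _).trans (max_le ?_ ?_)
    · exact natDegree_mul_le.trans (by lia)
    · rcases Nat.eq_zero_or_pos m with h0 | h0
      · rw [derivative_of_natDegree_zero h0]; simp
      · exact natDegree_mul_le.trans (by lia)

/-- The section of `V n` by a line parallel to a coordinate axis has at most `2 n` frontier points in
that line. -/
theorem exists_frontier_line_subset {n : ℕ} (hn : n ≠ 0) (b : Fin n → ℝ) (i : Fin n) :
    ∃ F : Finset ℝ, F.card ≤ 2 * n ∧ frontier {t : ℝ | Function.update b i t ∈ V n} ⊆ F := by
  classical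
  set h := traceP (Function.update b i 0) with hh
  set T := chebBasis (n - (i + 1)) with hT
  -- Recovers `t` from a root `c` of `h + t T`. If `T` vanishes at `c`, a double root still gives
  -- `t` through the derivatives, because the roots of `T` are simple.
  set τ : ℝ → ℝ := fun c => if T.eval c = 0 then -(derivative h).eval c / (derivative T).eval c
    else -h.eval c / T.eval c with hτ
  have hi := i.2
  have hTd : T.natDegree = n - (i + 1) := chebBasis_natDegree _
  have hhd : h.natDegree = n := traceP_natDegree _
  obtain ⟨hW, hWd⟩ := wronskian_ne_zero_of_monic (traceP_monic (Function.update b i 0))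
    (chebBasis_monic (n - (i + 1))) (by rw [← hh, ← hT, hTd, hhd]; lia)
  rw [← hh, ← hT] at hW hWd
  set W := derivative h * T - h * derivative T with hWdef
  refine ⟨((W * ((X - C 2) * (X + C 2))).roots.toFinset).image τ, ?_, ?_⟩
  -- The Wronskian has degree at most `n + (n - (i + 1)) - 1 ≤ 2 n - 2`; the candidates `±2` add
  -- two.
  · refine Finset.card_image_le.trans ((Multiset.toFinset_card_le _).trans
      ((card_roots' _).trans (natDegree_mul_le.trans ?_)))
    have : ((X - C 2) * (X + C 2) : ℝ[X]).natDegree ≤ 2 := by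
      refine natDegree_mul_le.trans ?_
      rw [natDegree_X_sub_C, natDegree_X_add_C]
    rw [hhd, hTd] at hWd
    lia
  · have hcont : Continuous fun t : ℝ => Function.update b i t := by fun_prop
    have hclosed : IsClosed {t : ℝ | Function.update b i t ∈ V n} :=
      (isCompact_V hn).isClosed.preimage hcont
    intro t ht
    have htV : Function.update b i t ∈ V n := hclosed.frontier_subset ht
    have hnint : Function.update b i t ∉ interior (V n) := fun hint =>
      ht.2 (mem_interior.2 ⟨_, Set.preimage_mono interior_subset,
        isOpen_interior.preimage hcont, hint⟩)
    rw [V_eq_image hn] at htV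
    obtain ⟨x, hx, hxt⟩ := htV
    have hprod : h + C t * T = ∏ j, (X - C (x j)) := by
      rw [hh, hT, ← traceP_update, ← hxt, traceP_coeffMap hn]
    have hroot : ∀ j, h.eval (x j) + t * T.eval (x j) = 0 := by
      intro j
      have := congrArg (eval (x j)) hprod
      rw [eval_prod, Finset.prod_eq_zero (Finset.mem_univ j) (by simp)] at this
      simpa using this
    have hne : W * ((X - C 2) * (X + C 2)) ≠ 0 :=
      mul_ne_zero hW (mul_ne_zero (X_sub_C_ne_zero 2) (X_add_C_ne_zero 2))
    suffices ∃ c, (W * ((X - C 2) * (X + C 2))).eval c = 0 ∧ τ c = t by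
      obtain ⟨c, hc, hct⟩ := this
      rw [Finset.mem_coe, Finset.mem_image]
      exact ⟨c, by rw [Multiset.mem_toFinset, mem_roots hne]; exact hc, hct⟩
    have hτ1 : ∀ c, T.eval c ≠ 0 → h.eval c + t * T.eval c = 0 → τ c = t := by
      intro c h1 h2
      rw [hτ]; simp only [if_neg h1]
      rw [div_eq_iff h1]; linarith
    by_cases hinj : Function.Injective x
    · have : ∃ j, x j = 2 ∨ x j = -2 := by
        by_contra! hcon
        refine hnint (hxt ▸ coeffMap_mem_interior_V hn hinj fun j => ?_)
        have := hx j (Set.mem_univ j)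
        exact ⟨lt_of_le_of_ne this.1 (hcon j).2.symm, lt_of_le_of_ne this.2 (hcon j).1⟩
      obtain ⟨j, hj | hj⟩ := this
      · refine ⟨2, by simp, hτ1 2 (chebBasis_eval_two_ne_zero _) ?_⟩
        have := hroot j; rwa [hj] at this
      · refine ⟨-2, by simp, hτ1 (-2) (chebBasis_eval_neg_two_ne_zero _) ?_⟩
        have := hroot j; rwa [hj] at this
    · rw [Function.Injective] at hinj
      push Not at hinj
      obtain ⟨j, k, hjk, hne'⟩ := hinj
      set c := x j with hc
      -- At a double root both `h + t T` and its derivative vanish; eliminating `t` gives a zero of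
      -- the Wronskian.
      have hder : (derivative h).eval c + t * (derivative T).eval c = 0 := by
        have h1 := congrArg (fun P => (derivative P).eval c) hprod
        have h2 : ∏ l, (X - C (x l)) = (X - C c) * ((X - C c) *
            ∏ l ∈ (Finset.univ.erase j).erase k, (X - C (x l))) := by
          rw [← Finset.mul_prod_erase Finset.univ _ (Finset.mem_univ j),
            ← Finset.mul_prod_erase (Finset.univ.erase j) _
              (Finset.mem_erase.2 ⟨hne'.symm, Finset.mem_univ k⟩), ← hjk]
        rw [h2] at h1
        simpa using h1
      have hr := hroot j
      refine ⟨c, ?_, ?_⟩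
      · rw [eval_mul, hWdef, eval_sub, eval_mul, eval_mul]
        have : (derivative h).eval c * T.eval c - h.eval c * (derivative T).eval c = 0 := by
          linear_combination T.eval c * hder - (derivative T).eval c * hr
        rw [this, zero_mul]
      · by_cases hT0 : T.eval c = 0
        · have hT' := chebBasis_derivative_eval_ne_zero hT0
          rw [hτ]; simp only [if_pos hT0]
          rw [div_eq_iff hT']; linarith
        · exact hτ1 c hT0 hr

end UnitCircleLattice

/-! ### The volume of `V n`. -/

namespace UnitCircleLattice

open Polynomial MeasureTheory Topology Function

/-- The points of `(-2, 2)ⁿ` with increasing coordinates. -/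
def chamber (n : ℕ) : Set (Fin n → ℝ) := {x | StrictMono x ∧ ∀ j, x j ∈ Set.Ioo (-2 : ℝ) 2}

theorem measurableSet_chamber (n : ℕ) : MeasurableSet (chamber n) := by
  have : chamber n = (⋂ i, ⋂ j, ⋂ _ : i < j, {x : Fin n → ℝ | x i < x j}) ∩
      Set.univ.pi fun _ => Set.Ioo (-2 : ℝ) 2 := by
    ext x; simp [chamber, StrictMono]
  rw [this]
  refine MeasurableSet.inter ?_ (MeasurableSet.univ_pi fun _ => measurableSet_Ioo)
  exact MeasurableSet.iInter fun i => MeasurableSet.iInter fun j => MeasurableSet.iInter fun _ =>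
    measurableSet_lt (measurable_pi_apply i) (measurable_pi_apply j)

theorem coeffMap_comp_perm {n : ℕ} (x : Fin n → ℝ) (σ : Equiv.Perm (Fin n)) :
    coeffMap (x ∘ σ) = coeffMap x := by
  have : reciprocalP (x ∘ σ) = reciprocalP x :=
    Equiv.prod_comp σ fun j => (X ^ 2 - C (x j) * X + 1 : ℝ[X])
  funext i
  rw [coeffMap, this, coeffMap]

/-- The coefficients determine the set of roots, and a strictly increasing tuple is determined by
its range. -/
theorem injOn_coeffMap {n : ℕ} (hn : n ≠ 0) : Set.InjOn coeffMap (chamber n) := by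
  intro x hx y hy hxy
  have h : ∏ j, (X - C (x j)) = ∏ j, (X - C (y j)) := by
    rw [← traceP_coeffMap hn, hxy, traceP_coeffMap hn]
  have hr : ∀ (z : Fin n → ℝ) (c : ℝ), c ∈ Set.range z ↔ (∏ j, (X - C (z j))).eval c = 0 := by
    intro z c
    rw [eval_prod, Finset.prod_eq_zero_iff]
    simp [sub_eq_zero, eq_comm]
  refine (StrictMono.range_inj hx.1 hy.1).1 ?_
  ext c
  rw [hr, hr, h]

/-- The points of `ℝⁿ` with two equal coordinates or a coordinate equal to `±2`. -/
def degenerateSet (n : ℕ) : Set (Fin n → ℝ) := {x | ¬ Injective x ∨ ∃ j, x j = 2 ∨ x j = -2}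

theorem volume_degenerateSet (n : ℕ) : volume (degenerateSet n) = 0 := by
  have hsub : degenerateSet n ⊆ (⋃ i, ⋃ j, ⋃ _ : i ≠ j, {x : Fin n → ℝ | x i = x j}) ∪
      ⋃ j, ({x : Fin n → ℝ | x j = 2} ∪ {x : Fin n → ℝ | x j = -2}) := by
    rintro x (hx | ⟨j, hj⟩)
    · rw [Injective] at hx
      push Not at hx
      obtain ⟨i, j, hij, hne⟩ := hx
      left
      simp only [Set.mem_iUnion]
      exact ⟨i, j, hne, hij⟩
    · right
      simp only [Set.mem_iUnion]
      exact ⟨j, hj⟩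
  refine measure_mono_null hsub (measure_union_null ?_ ?_)
  · refine measure_iUnion_null fun i => measure_iUnion_null fun j => measure_iUnion_null fun hij => ?_
    let f : (Fin n → ℝ) →ₗ[ℝ] ℝ :=
      (LinearMap.proj i : (Fin n → ℝ) →ₗ[ℝ] ℝ) - (LinearMap.proj j : (Fin n → ℝ) →ₗ[ℝ] ℝ)
    have hf : ∀ x, f x = x i - x j := fun x => rfl
    have := Measure.addHaar_submodule (volume : Measure (Fin n → ℝ)) (LinearMap.ker f) (by
      intro h
      have h1 : (Pi.single i 1 : Fin n → ℝ) ∈ LinearMap.ker f := by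
        rw [h]; exact Submodule.mem_top
      rw [LinearMap.mem_ker, hf] at h1
      simp [hij.symm] at h1)
    convert this using 2
    ext x
    simp [hf, sub_eq_zero]
  · exact measure_iUnion_null fun j => measure_union_null
      (Measure.pi_hyperplane (fun _ : Fin n => (volume : Measure ℝ)) j 2)
      (Measure.pi_hyperplane (fun _ : Fin n => (volume : Measure ℝ)) j (-2))

theorem exists_perm_comp_mem_chamber {n : ℕ} {x : Fin n → ℝ}
    (hx : x ∈ Set.univ.pi fun _ : Fin n => Set.Icc (-2 : ℝ) 2) (hd : x ∉ degenerateSet n) :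
    ∃ σ : Equiv.Perm (Fin n), x ∘ σ ∈ chamber n := by
  simp only [degenerateSet, Set.mem_ofPred_eq, not_or, not_not, not_exists] at hd
  refine ⟨Tuple.sort x, (Tuple.monotone_sort x).strictMono_of_injective
    (hd.1.comp (Tuple.sort x).injective), fun j => ?_⟩
  have h1 := hx (Tuple.sort x j) (Set.mem_univ _)
  have h2 := hd.2 (Tuple.sort x j)
  exact ⟨lt_of_le_of_ne h1.1 (Ne.symm h2.2), lt_of_le_of_ne h1.2 h2.1⟩

theorem measurePreserving_comp_perm {n : ℕ} (σ : Equiv.Perm (Fin n)) :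
    MeasurePreserving (fun x : Fin n → ℝ => x ∘ σ) := by
  have h := volume_measurePreserving_piCongrLeft (fun _ : Fin n => ℝ) σ.symm
  have e : (fun x : Fin n → ℝ => x ∘ σ) =
      MeasurableEquiv.piCongrLeft (fun _ : Fin n => ℝ) σ.symm := by
    funext x i
    have := MeasurableEquiv.piCongrLeft_apply_apply (β := fun _ : Fin n => ℝ) σ.symm x (σ i)
    simpa using this.symm
  rw [e]
  exact h

/-- Up to `degenerateSet`, the cube is the disjoint union of the `n!` permuted chambers, and the
integrand is symmetric. -/
theorem factorial_mul_lintegral_chamber (n : ℕ) :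
    (n.factorial : ENNReal) * ∫⁻ x in chamber n, ENNReal.ofReal (absVandermonde x) =
      ∫⁻ x in Set.univ.pi fun _ : Fin n => Set.Icc (-2 : ℝ) 2,
        ENNReal.ofReal (absVandermonde x) := by
  have hae : (Set.univ.pi fun _ : Fin n => Set.Icc (-2 : ℝ) 2) =ᵐ[volume]
      ⋃ σ : Equiv.Perm (Fin n), (fun x : Fin n → ℝ => x ∘ σ) ⁻¹' chamber n := by
    have h0 : ∀ᵐ x : Fin n → ℝ, x ∉ degenerateSet n :=
      measure_eq_zero_iff_ae_notMem.1 (volume_degenerateSet n)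
    filter_upwards [h0] with x hx
    refine propext ⟨fun h => ?_, fun h => ?_⟩
    · obtain ⟨σ, hσ⟩ := exists_perm_comp_mem_chamber h hx
      exact Set.mem_iUnion.2 ⟨σ, hσ⟩
    · obtain ⟨σ, hσ⟩ := Set.mem_iUnion.1 h
      intro j _
      have := hσ.2 (σ.symm j)
      simp only [comp_apply, Equiv.apply_symm_apply] at this
      exact Set.Ioo_subset_Icc_self this
  rw [setLIntegral_congr hae, lintegral_iUnion]
  · have : ∀ σ : Equiv.Perm (Fin n), ∫⁻ x in (fun x : Fin n → ℝ => x ∘ σ) ⁻¹' chamber n,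
        ENNReal.ofReal (absVandermonde x) =
        ∫⁻ x in chamber n, ENNReal.ofReal (absVandermonde x) := by
      intro σ
      rw [← (measurePreserving_comp_perm σ).setLIntegral_comp_preimage (measurableSet_chamber n)
        (f := fun x => ENNReal.ofReal (absVandermonde x))
        (ENNReal.measurable_ofReal.comp continuous_absVandermonde.measurable)]
      simp only [absVandermonde_comp_perm]
    simp_rw [this]
    rw [tsum_fintype, Finset.sum_const, Finset.card_univ, Fintype.card_perm, Fintype.card_fin,
      nsmul_eq_mul]
  · exact fun σ => (measurePreserving_comp_perm σ).measurable (measurableSet_chamber n)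
  · intro σ τ hστ
    refine Set.disjoint_left.2 fun x hσ hτ => hστ ?_
    have h := Tuple.unique_monotone (f := x) hσ.1.monotone hτ.1.monotone
    have hinj : Injective x := by
      have : x = (x ∘ σ) ∘ σ.symm := by funext i; simp
      rw [this]
      exact hσ.1.injective.comp σ.symm.injective
    ext i
    exact congrArg Fin.val (hinj (congrFun h i))

theorem v_nonneg (n : ℕ) : 0 ≤ v n := by
  refine mul_nonneg (by positivity) (Finset.prod_nonneg fun j hj => pow_nonneg ?_ _)
  have : (1 : ℝ) ≤ j := by exact_mod_cast (Finset.mem_Icc.1 hj).1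
  exact div_nonneg (by linarith) (by linarith)

/-- The volume of `V n`. -/
theorem volume_V {n : ℕ} (hn : n ≠ 0) : volume.real (V n) = v n := by
  set Q := Set.univ.pi fun _ : Fin n => Set.Icc (-2 : ℝ) 2 with hQ
  -- A differentiable map sends null sets to null sets, so only the chamber, where `coeffMap` is
  -- injective, contributes volume.
  have hnull : volume (coeffMap '' degenerateSet n) = 0 :=
    addHaar_image_eq_zero_of_differentiableOn_of_addHaar_eq_zero volume
      (fun x _ => (hasStrictFDerivAt_coeffMap x).hasFDerivAt.differentiableAt.differentiableWithinAt)
      (volume_degenerateSet n)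
  have h1 : volume (V n) = volume (coeffMap '' chamber n) := by
    refine le_antisymm ?_ (measure_mono ?_)
    · have hsub : V n ⊆ coeffMap '' chamber n ∪ coeffMap '' degenerateSet n := by
        rw [V_eq_image hn]
        rintro _ ⟨x, hx, rfl⟩
        by_cases hd : x ∈ degenerateSet n
        · exact Or.inr ⟨x, hd, rfl⟩
        · obtain ⟨σ, hσ⟩ := exists_perm_comp_mem_chamber hx hd
          exact Or.inl ⟨_, hσ, coeffMap_comp_perm x σ⟩
      refine (measure_mono hsub).trans ((measure_union_le _ _).trans ?_)
      rw [hnull, add_zero]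
    · rw [V_eq_image hn]
      exact Set.image_mono fun x hx j _ => Set.Ioo_subset_Icc_self (hx.2 j)
  have h2 : volume (coeffMap '' chamber n) =
      ∫⁻ x in chamber n, ENNReal.ofReal (absVandermonde x) := by
    rw [← lintegral_abs_det_fderiv_eq_addHaar_image volume (measurableSet_chamber n)
      (fun x _ => (hasStrictFDerivAt_coeffMap x).hasFDerivAt.hasFDerivWithinAt) (injOn_coeffMap hn)]
    refine setLIntegral_congr_fun (measurableSet_chamber n) fun x hx => ?_
    simp only [abs_det_fderiv_coeffMap hn hx.1.injective]
  have h3 := factorial_mul_lintegral_chamber n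
  rw [← h2, ← h1, ← hQ, ← ofReal_integral_eq_lintegral_ofReal
    (by rw [← cubeMeasure_eq]; exact integrable_cubeMeasure_of_continuous continuous_absVandermonde)
    (Filter.Eventually.of_forall absVandermonde_nonneg), ← cubeMeasure_eq,
    integral_absVandermonde] at h3
  have h4 := congrArg ENNReal.toReal h3
  rw [ENNReal.toReal_mul, ENNReal.toReal_natCast, ENNReal.toReal_ofReal
    (mul_nonneg (by positivity) (v_nonneg n))] at h4
  exact mul_left_cancel₀ (by positivity) h4

end UnitCircleLattice

/-! ### Lattice counts and explicit constants. -/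

namespace UnitCircleLattice

open MeasureTheory Function

/-- The points of a lattice generated by multiples of the standard basis vectors. -/
theorem mem_closure_range_single_iff {n : ℕ} (d : Fin n → ℝ) (x : Fin n → ℝ) :
    x ∈ AddSubgroup.closure (Set.range fun i : Fin n => (Pi.single i (d i) : Fin n → ℝ)) ↔
      ∃ k : Fin n → ℤ, (fun i => d i * (k i : ℝ)) = x := by
  constructor
  · intro hx
    induction hx using AddSubgroup.closure_induction with
    | mem x hx =>
      obtain ⟨i, rfl⟩ := hx
      refine ⟨Pi.single i 1, funext fun j => ?_⟩
      rcases eq_or_ne j i with rfl | h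
      · simp
      · simp [h]
    | zero => exact ⟨0, by funext; simp⟩
    | add x y _ _ hx hy =>
      obtain ⟨k, rfl⟩ := hx
      obtain ⟨l, rfl⟩ := hy
      exact ⟨k + l, by funext; simp; ring⟩
    | neg x _ hx =>
      obtain ⟨k, rfl⟩ := hx
      exact ⟨-k, by funext; simp⟩
  · rintro ⟨k, rfl⟩
    have : (fun i => d i * (k i : ℝ)) = ∑ i, k i • (Pi.single i (d i) : Fin n → ℝ) := by
      funext j
      rw [Finset.sum_apply, Finset.sum_eq_single j]
      · simp [mul_comm]
      · intro i _ hij; simp [hij.symm]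
      · simp
    rw [this]
    exact sum_mem fun i _ => AddSubgroup.zsmul_mem _ (AddSubgroup.subset_closure (Set.mem_range_self i)) _

theorem volume_real_preimage_mul {n : ℕ} {d : Fin n → ℝ} (hd : ∀ i, 0 < d i)
    (S : Set (Fin n → ℝ)) :
    volume.real {y : Fin n → ℝ | (fun i => d i * y i) ∈ S} = volume.real S / ∏ i, d i := by
  have hprod : 0 < ∏ i, d i := Finset.prod_pos fun i _ => hd i
  have hdet : LinearMap.det (Matrix.toLin' (Matrix.diagonal d)) = ∏ i, d i := by
    rw [LinearMap.det_toLin', Matrix.det_diagonal]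
  have h := Measure.addHaar_preimage_linearMap (volume : Measure (Fin n → ℝ))
    (f := Matrix.toLin' (Matrix.diagonal d)) (by rw [hdet]; exact hprod.ne') S
  have hset : (Matrix.toLin' (Matrix.diagonal d)) ⁻¹' S =
      {y : Fin n → ℝ | (fun i => d i * y i) ∈ S} := by
    ext y
    have : Matrix.toLin' (Matrix.diagonal d) y = fun i => d i * y i := by
      funext i; simp [Matrix.mulVec_diagonal]
    simp only [Set.mem_preimage, this]; rfl
  rw [hset, hdet, abs_of_pos (inv_pos.2 hprod)] at h
  rw [Measure.real, h, ENNReal.toReal_mul, ENNReal.toReal_ofReal (inv_pos.2 hprod).le, Measure.real]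
  rw [div_eq_inv_mul]

/-- The number of points of `V n` on a lattice generated by multiples of the standard basis
vectors. -/
theorem abs_ncard_lattice_inter_V_sub_le {n : ℕ} (hn : n ≠ 0) {d : Fin n → ℝ} (hd : ∀ i, 0 < d i) :
    ((AddSubgroup.closure (Set.range fun i : Fin n => (Pi.single i (d i) : Fin n → ℝ)) :
        Set (Fin n → ℝ)) ∩ V n).Finite ∧
    |(((AddSubgroup.closure (Set.range fun i : Fin n => (Pi.single i (d i) : Fin n → ℝ)) :
        Set (Fin n → ℝ)) ∩ V n).ncard : ℝ) - v n / ∏ i, d i| ≤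
      4 * n * ∑ k : Fin n, ∏ j ∈ Finset.univ.erase k,
        (2 * (((2 * n).choose (j + 1) : ℝ) / d j) + 1) := by
  set S : Set (Fin n → ℝ) := {y | (fun i => d i * y i) ∈ V n} with hS
  have hcont : Continuous fun y : Fin n → ℝ => (fun i => d i * y i) := by fun_prop
  have hSm : MeasurableSet S := (isCompact_V hn).isClosed.measurableSet.preimage hcont.measurable
  have hbox : ∀ y ∈ S, ∀ i, |y i| ≤ ((2 * n).choose (i + 1) : ℝ) / d i := by
    intro y hy i
    rw [le_div_iff₀ (hd i)]
    have := abs_le_choose_of_mem_V hn hy i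
    rwa [abs_mul, abs_of_pos (hd i), mul_comm] at this
  have himg : (AddSubgroup.closure (Set.range fun i : Fin n => (Pi.single i (d i) : Fin n → ℝ)) :
      Set (Fin n → ℝ)) ∩ V n =
      (fun k : Fin n → ℤ => fun i => d i * (k i : ℝ)) '' {k | (fun i => (k i : ℝ)) ∈ S} := by
    ext x
    constructor
    · rintro ⟨h1, h2⟩
      obtain ⟨k, rfl⟩ := (mem_closure_range_single_iff d x).1 h1
      exact ⟨k, h2, rfl⟩
    · rintro ⟨k, hk, rfl⟩
      exact ⟨(mem_closure_range_single_iff d _).2 ⟨k, rfl⟩, hk⟩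
  have hinj : Injective (fun k : Fin n → ℤ => fun i => d i * (k i : ℝ)) := by
    intro k l h
    funext i
    have := congrFun h i
    simpa [(hd i).ne'] using this
  rw [himg, Set.ncard_image_of_injective _ hinj]
  refine ⟨(finite_int_points hbox).image _, ?_⟩
  rw [← volume_V hn, ← volume_real_preimage_mul hd]
  refine abs_ncard_int_points_sub_volume_le hSm (fun i => div_nonneg (by positivity) (hd i).le) hbox
    (by positivity) fun y i => ?_
  -- A line section of the rescaled set is a dilate of a line section of `V n`, so it again has at
  -- most `2 n` frontier points, and the line error is at most `4 n`.
  obtain ⟨F, hF, hFs⟩ := exists_frontier_line_subset hn (fun j => d j * y j) i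
  set A := {t : ℝ | update y i t ∈ S}
  set e := Homeomorph.mulLeft₀ (d i) (hd i).ne'
  have hA : A = e ⁻¹' {t : ℝ | update (fun j => d j * y j) i t ∈ V n} := by
    ext t
    have : (fun j => d j * update y i t j) = update (fun j => d j * y j) i (d i * t) := by
      funext j
      rcases eq_or_ne j i with rfl | h
      · simp
      · simp [h]
    change (fun j => d j * update y i t j) ∈ V n ↔ _
    rw [this]; rfl
  have hAm : MeasurableSet A := hSm.preimage (measurable_update y)
  have hfr : frontier A ⊆ (F.image e.symm : Finset ℝ) := by
    rw [hA, ← e.preimage_frontier]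
    intro t ht
    rw [Finset.coe_image]
    exact ⟨e t, hFs ht, e.symm_apply_apply t⟩
  have hbound : ∀ t ∈ A, |t| ≤ ((2 * n).choose (i + 1) : ℝ) / d i := by
    intro t ht
    simpa using hbox _ ht i
  refine (abs_ncard_int_sub_volume_le hAm hbound _ hfr).trans ?_
  have : ((F.image e.symm).card : ℝ) ≤ 2 * n := by
    exact_mod_cast Finset.card_image_le.trans hF
  linarith

/-- The central binomial coefficient at most quadruples at each step, starting from `13 ≤ 16` at `n
= 2`. The bound fails for `n = 1`. -/
theorem two_mul_choose_add_one_le {n : ℕ} (hn : 1 < n) (j : ℕ) :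
    2 * (2 * n).choose j + 1 ≤ 4 ^ n := by
  have h : ∀ m, 2 ≤ m → 2 * m.centralBinom + 1 ≤ 4 ^ m := by
    intro m hm
    induction m, hm using Nat.le_induction with
    | base => simp [Nat.centralBinom, Nat.choose]
    | succ m _ ih =>
      have h1 := Nat.succ_mul_centralBinom_succ m
      have h2 : (m + 1).centralBinom ≤ 4 * m.centralBinom := by
        refine Nat.le_of_mul_le_mul_left (c := m + 1) ?_ (by lia)
        rw [h1]
        nlinarith [Nat.zero_le m.centralBinom]
      rw [pow_succ]
      lia
  have := Nat.choose_le_centralBinom j n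
  have := h n hn
  lia

/-- The inductive step is Bernoulli: `(3 / 2) ^ (2 n + 1) ≥ n + 1`. -/
theorem factorial_le_pow_sq {n : ℕ} : (n.factorial : ℝ) ≤ (3 / 2 : ℝ) ^ (n ^ 2) := by
  induction n with
  | zero => simp
  | succ n ih =>
    rw [Nat.factorial_succ, Nat.cast_mul, show (n + 1) ^ 2 = (2 * n + 1) + n ^ 2 by ring, pow_add]
    refine mul_le_mul ?_ ih (by positivity) (by positivity)
    have := one_add_mul_le_pow (a := (1 / 2 : ℝ)) (by norm_num) (2 * n + 1)
    norm_num at this ⊢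
    linarith

theorem two_le_c₃ : 2 ≤ c₃ := by
  have h2 : (1 : ℝ) + √2 ≠ 0 := by positivity
  have h3 : (1.7 : ℝ) ≤ √3 := Real.le_sqrt_of_sq_le (by norm_num)
  have he : (2.5 : ℝ) ≤ Real.exp (3 / 2) := by
    have := Real.add_one_le_exp (3 / 2 : ℝ); linarith
  have hp : (1 : ℝ) ≤ (1 + √3 / 162) ^ 3 := one_le_pow₀ (by
    have : 0 ≤ √3 / 162 := by positivity
    linarith)
  have : c₃ = Real.exp (3 / 2) * √3 * (1 + √3 / 162) ^ 3 * (2 / 3) := by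
    rw [c₃, c₂]; field_simp
  rw [this]
  have h4 : (2.5 : ℝ) * 1.7 ≤ Real.exp (3 / 2) * √3 :=
    mul_le_mul he h3 (by norm_num) (by positivity)
  have h5 : (2.5 : ℝ) * 1.7 * 1 ≤ Real.exp (3 / 2) * √3 * (1 + √3 / 162) ^ 3 :=
    mul_le_mul h4 hp (by norm_num) (by positivity)
  linarith

theorem quarter_le_c₁ : 1 / 4 ≤ c₁ := by
  have h3 : (1.7 : ℝ) ≤ √3 := Real.le_sqrt_of_sq_le (by norm_num)
  rw [c₁]; linarith

/-- The surplus `(6 / 4) ^ (n ^ 2)` pays for `n!`, while `c₁ ≥ 1 / 4` absorbs the missing `4 ^ n`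
and `c₃ ≥ 2` part of the factor `4`. -/
theorem error_constant_le {n : ℕ} (hn : 1 < n) :
    4 * (n : ℝ) * (n * (4 ^ n) ^ (n - 1)) ≤
      6 ^ (n ^ 2) * c₁ ^ n * c₃ * ((n : ℝ) * (n + 1) / ((n - 1).factorial : ℝ)) := by
  obtain ⟨m, rfl⟩ : ∃ m, n = m + 1 := ⟨n - 1, by lia⟩
  rw [Nat.add_sub_cancel]
  set N := m + 1 with hN
  have hf : (0 : ℝ) < m.factorial := by positivity
  have h4 : ((4 : ℝ) ^ N) ^ m = 4 ^ (N ^ 2) * (1 / 4) ^ N := by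
    rw [← pow_mul, one_div, inv_pow, eq_mul_inv_iff_mul_eq₀ (by positivity), ← pow_add]
    congr 1; rw [hN]; ring
  have h6 : (6 : ℝ) ^ (N ^ 2) = 4 ^ (N ^ 2) * (3 / 2) ^ (N ^ 2) := by
    rw [← mul_pow]; norm_num
  have hfac : (N : ℝ) * m.factorial ≤ (3 / 2 : ℝ) ^ (N ^ 2) := by
    have := factorial_le_pow_sq (n := N)
    rwa [hN, Nat.factorial_succ, Nat.cast_mul, ← hN] at this
  have hN2 : (2 : ℝ) ≤ N := by exact_mod_cast hn
  have hpow : (1 / 4 : ℝ) ^ N ≤ c₁ ^ N := pow_le_pow_left₀ (by norm_num) quarter_le_c₁ N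
  have hc : (1 / 4 : ℝ) ^ N * 2 ≤ c₁ ^ N * c₃ :=
    mul_le_mul hpow two_le_c₃ (by norm_num) (le_trans (by positivity) hpow)
  have hc0 : (0 : ℝ) ≤ c₁ ^ N * c₃ := le_trans (by positivity) hc
  rw [h4, h6, mul_div_assoc', le_div_iff₀ hf]
  calc 4 * (N : ℝ) * (N * (4 ^ (N ^ 2) * (1 / 4) ^ N)) * m.factorial
      = 4 ^ (N ^ 2) * N * ((N * m.factorial) * ((1 / 4) ^ N * 2) * 2) := by ring
    _ ≤ 4 ^ (N ^ 2) * N * ((3 / 2) ^ (N ^ 2) * (c₁ ^ N * c₃) * (N + 1)) := by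
        refine mul_le_mul_of_nonneg_left ?_ (by positivity)
        refine mul_le_mul (mul_le_mul hfac hc (by positivity) (by positivity)) (by linarith)
          (by norm_num) (mul_nonneg (by positivity) hc0)
    _ = _ := by ring

theorem sum_fin_add_one_div_two (n : ℕ) :
    ∑ i : Fin n, (((i : ℕ) : ℝ) + 1) / 2 = (n : ℝ) * (n + 1) / 4 := by
  rw [Fin.sum_univ_eq_sum_range fun i => ((i : ℝ) + 1) / 2]
  induction n with
  | zero => simp
  | succ n ih => rw [Finset.sum_range_succ, ih]; push_cast; ring

/-- The number of points of `V n` on the lattice generated by `q^(-i/2) eᵢ` for `1 ≤ i < n` and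
`t q^(-n/2) eₙ`. -/
theorem scaledLattice_inter_V {n q t : ℕ} (hn : 1 < n) (ht : 1 ≤ t) (htq : t ≤ q) :
    ((scaledLattice n q t : Set (Fin n → ℝ)) ∩ V n).Finite ∧
    |(((scaledLattice n q t : Set (Fin n → ℝ)) ∩ V n).ncard : ℝ)
        - v n * (q : ℝ) ^ ((n : ℝ) * (n + 1) / 4) / t| ≤
      6 ^ (n ^ 2) * c₁ ^ n * c₃ * ((n : ℝ) * (n + 1) / ((n - 1).factorial : ℝ)) *
        (q : ℝ) ^ (((n : ℝ) + 2) * ((n : ℝ) - 1) / 4) := by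
  have hn0 : n ≠ 0 := by lia
  have hq1 : (1 : ℝ) ≤ q := by exact_mod_cast ht.trans htq
  have hq0 : (0 : ℝ) < q := by linarith
  have ht1 : (1 : ℝ) ≤ t := by exact_mod_cast ht
  have ht0 : (0 : ℝ) < t := by linarith
  have htq' : (t : ℝ) ≤ q := by exact_mod_cast htq
  set d : Fin n → ℝ := fun i => (if (i : ℕ) + 1 = n then (t : ℝ) else 1) *
      (q : ℝ) ^ (-(((i : ℕ) : ℝ) + 1) / 2) with hd
  have hd0 : ∀ i, 0 < d i := by
    intro i
    simp only [hd]
    split_ifs <;> positivity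
  -- Spacings at most `1` let the `+ 1` in each side length be absorbed into a multiple of `1 / d
  -- j`. For the last one, `t ≤ q` and `n ≥ 2` suffice.
  have hdle : ∀ i, d i ≤ 1 := by
    intro i
    simp only [hd]
    split_ifs with h
    · have hi : ((i : ℕ) : ℝ) + 1 = n := by exact_mod_cast h
      have hn2 : (2 : ℝ) ≤ n := by exact_mod_cast hn
      calc (t : ℝ) * (q : ℝ) ^ (-(((i : ℕ) : ℝ) + 1) / 2)
          ≤ q * (q : ℝ) ^ (-(((i : ℕ) : ℝ) + 1) / 2) :=
            mul_le_mul_of_nonneg_right htq' (by positivity)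
        _ = (q : ℝ) ^ (1 + -(((i : ℕ) : ℝ) + 1) / 2) := by
            rw [Real.rpow_add hq0, Real.rpow_one]
        _ ≤ 1 := Real.rpow_le_one_of_one_le_of_nonpos hq1 (by rw [hi]; linarith)
    · rw [one_mul]
      refine Real.rpow_le_one_of_one_le_of_nonpos hq1 ?_
      have : (0 : ℝ) ≤ ((i : ℕ) : ℝ) := by positivity
      linarith
  -- Discarding `t ≥ 1` here makes the error bound uniform in `t`.
  have hdinv : ∀ i, 1 / d i ≤ (q : ℝ) ^ ((((i : ℕ) : ℝ) + 1) / 2) := by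
    intro i
    have h1 : (q : ℝ) ^ (-(((i : ℕ) : ℝ) + 1) / 2) ≤ d i := by
      simp only [hd]
      refine le_mul_of_one_le_left (by positivity) ?_
      split_ifs
      · exact ht1
      · exact le_rfl
    calc 1 / d i ≤ 1 / (q : ℝ) ^ (-(((i : ℕ) : ℝ) + 1) / 2) :=
          one_div_le_one_div_of_le (by positivity) h1
      _ = _ := by rw [neg_div, Real.rpow_neg hq0.le, one_div, inv_inv]
  have hprod : ∏ i, d i = t / (q : ℝ) ^ ((n : ℝ) * (n + 1) / 4) := by
    simp only [hd]
    rw [Finset.prod_mul_distrib]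
    have e1 : ∏ i : Fin n, (if (i : ℕ) + 1 = n then (t : ℝ) else 1) = t := by
      rw [Finset.prod_eq_single (⟨n - 1, by lia⟩ : Fin n)]
      · rw [if_pos (by simp; lia)]
      · intro i _ hi
        rw [if_neg]
        intro h
        exact hi (Fin.ext (by simp; lia))
      · simp
    have e2 : ∏ i : Fin n, (q : ℝ) ^ (-(((i : ℕ) : ℝ) + 1) / 2) =
        ((q : ℝ) ^ ((n : ℝ) * (n + 1) / 4))⁻¹ := by
      rw [← Real.rpow_sum_of_pos hq0, ← Real.rpow_neg hq0.le, ← sum_fin_add_one_div_two,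
        ← Finset.sum_neg_distrib]
      simp_rw [neg_div]
    rw [e1, e2, ← div_eq_mul_inv]
  have hmain := abs_ncard_lattice_inter_V_sub_le hn0 hd0
  have hlat : scaledLattice n q t = AddSubgroup.closure
      (Set.range fun i : Fin n => (Pi.single i (d i) : Fin n → ℝ)) := rfl
  rw [← hlat, hprod, div_div_eq_mul_div] at hmain
  refine ⟨hmain.1, hmain.2.trans ?_⟩
  set E := (q : ℝ) ^ (((n : ℝ) + 2) * ((n : ℝ) - 1) / 4)
  have hterm : ∀ k : Fin n, ∏ j ∈ Finset.univ.erase k,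
      (2 * (((2 * n).choose (j + 1) : ℝ) / d j) + 1) ≤ (4 ^ n) ^ (n - 1) * E := by
    intro k
    have h1 : ∀ j : Fin n, 2 * (((2 * n).choose (j + 1) : ℝ) / d j) + 1 ≤
        4 ^ n * (q : ℝ) ^ ((((j : ℕ) : ℝ) + 1) / 2) := by
      intro j
      have hch : 2 * ((2 * n).choose (j + 1) : ℝ) + 1 ≤ 4 ^ n := by
        exact_mod_cast two_mul_choose_add_one_le hn (j + 1)
      have hone : 1 ≤ 1 / d j := (one_le_div (hd0 j)).2 (hdle j)
      calc 2 * (((2 * n).choose (j + 1) : ℝ) / d j) + 1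
          ≤ 2 * (((2 * n).choose (j + 1) : ℝ) / d j) + 1 / d j := by linarith
        _ = (2 * ((2 * n).choose (j + 1) : ℝ) + 1) * (1 / d j) := by ring
        _ ≤ _ := mul_le_mul hch (hdinv j) (by linarith) (by positivity)
    refine (Finset.prod_le_prod (fun j _ => ?_) fun j _ => h1 j).trans ?_
    · have := (hd0 j).le
      positivity
    rw [Finset.prod_mul_distrib, Finset.prod_const, Finset.card_erase_of_mem (Finset.mem_univ k),
      Finset.card_univ, Fintype.card_fin, ← Real.rpow_sum_of_pos hq0]
    -- Omitting index `k` lowers the exponent `n (n + 1) / 4` by `(k + 1) / 2`. The worst case `k =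
    -- 0` leaves `(n + 2) (n - 1) / 4`.
    refine mul_le_mul_of_nonneg_left (Real.rpow_le_rpow_of_exponent_le hq1 ?_) (by positivity)
    have h2 := Finset.add_sum_erase Finset.univ (fun i : Fin n => (((i : ℕ) : ℝ) + 1) / 2)
      (Finset.mem_univ k)
    rw [sum_fin_add_one_div_two] at h2
    have : (0 : ℝ) ≤ ((k : ℕ) : ℝ) := by positivity
    linarith
  calc _ ≤ 4 * (n : ℝ) * (n * ((4 ^ n) ^ (n - 1) * E)) := by
        refine mul_le_mul_of_nonneg_left ?_ (by positivity)
        refine (Finset.sum_le_card_nsmul _ _ _ fun k _ => hterm k).trans ?_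
        simp
    _ = 4 * (n : ℝ) * (n * (4 ^ n) ^ (n - 1)) * E := by ring
    _ ≤ _ := mul_le_mul_of_nonneg_right (error_constant_le hn) (by positivity)

/-- The number `q` is itself an admissible power of `p`, so the infimum is attained and is at most
`q`. -/
theorem s_spec {p a q : ℕ} (hp : p.Prime) (hq : q = p ^ a) :
    1 ≤ s p q ∧ s p q ≤ q ∧ q ≤ s p q ^ 2 := by
  have hmem : q ∈ {m : ℕ | (∃ k : ℕ, m = p ^ k) ∧ q ∣ m ^ 2} := ⟨⟨a, hq⟩, dvd_pow_self q two_ne_zero⟩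
  obtain ⟨⟨k, hk⟩, hdvd⟩ := Nat.sInf_mem ⟨q, hmem⟩
  have hpos : 1 ≤ s p q := by
    rw [s, hk]; exact Nat.one_le_pow _ _ hp.pos
  exact ⟨hpos, Nat.sInf_le hmem, Nat.le_of_dvd (by positivity) hdvd⟩

theorem r_prime_pow {p a : ℕ} (hp : p.Prime) (ha : 0 < a) : r (p ^ a) = 1 - 1 / p := by
  have hp0 : (p : ℝ) ≠ 0 := by exact_mod_cast hp.ne_zero
  obtain ⟨b, rfl⟩ : ∃ b, a = b + 1 := ⟨a - 1, by lia⟩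
  rw [r, Nat.totient_prime_pow_succ hp, Nat.cast_mul, Nat.cast_pow, Nat.cast_pow,
    Nat.cast_sub hp.one_le, pow_succ, Nat.cast_one]
  field_simp

end UnitCircleLattice


theorem proposition3p2p1 (p a q n : ℕ) (hp : p.Prime) (ha : 0 < a) (hq : q = p ^ a)
    (hn : 1 < n) :
    ((UnitCircleLattice.Lam n q : Set (Fin n → ℝ)) ∩ UnitCircleLattice.V n).Finite ∧
    ((UnitCircleLattice.Lam' n p q : Set (Fin n → ℝ)) ∩ UnitCircleLattice.V n).Finite ∧
    ((UnitCircleLattice.Lam'' n p q : Set (Fin n → ℝ)) ∩ UnitCircleLattice.V n).Finite ∧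
    |((((UnitCircleLattice.Lam n q : Set (Fin n → ℝ)) ∩ UnitCircleLattice.V n).ncard : ℕ) : ℝ)
        - ((((UnitCircleLattice.Lam' n p q : Set (Fin n → ℝ)) ∩
              UnitCircleLattice.V n).ncard : ℕ) : ℝ)
        - UnitCircleLattice.v n * UnitCircleLattice.r q *
            (q : ℝ) ^ ((n : ℝ) * ((n : ℝ) + 1) / 4)|
      ≤ (6 : ℝ) ^ (n ^ 2) * UnitCircleLattice.c₁ ^ n * UnitCircleLattice.c₂ *
          ((n : ℝ) * ((n : ℝ) + 1) / ((n - 1).factorial : ℝ)) *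
          (q : ℝ) ^ (((n : ℝ) + 2) * ((n : ℝ) - 1) / 4) ∧
    ((((UnitCircleLattice.Lam'' n p q : Set (Fin n → ℝ)) ∩
          UnitCircleLattice.V n).ncard : ℕ) : ℝ)
      ≤ (UnitCircleLattice.v n +
            (6 : ℝ) ^ (n ^ 2) * UnitCircleLattice.c₁ ^ n * UnitCircleLattice.c₃ *
              ((n : ℝ) * ((n : ℝ) + 1) / ((n - 1).factorial : ℝ))) *
          (q : ℝ) ^ (((n : ℝ) + 2) * ((n : ℝ) - 1) / 4) := by
  have hpq : p ≤ q := hq ▸ Nat.le_self_pow ha.ne' p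
  have hq1 : 1 ≤ q := hp.one_le.trans hpq
  have hq0 : (0 : ℝ) < q := by exact_mod_cast hq1
  have hp0 : (0 : ℝ) < p := by exact_mod_cast hp.pos
  obtain ⟨hs1, hs2, hs3⟩ := UnitCircleLattice.s_spec hp hq
  obtain ⟨f1, e1⟩ := UnitCircleLattice.scaledLattice_inter_V hn le_rfl hq1
  obtain ⟨f2, e2⟩ := UnitCircleLattice.scaledLattice_inter_V hn hp.one_le hpq
  obtain ⟨f3, e3⟩ := UnitCircleLattice.scaledLattice_inter_V hn hs1 hs2
  refine ⟨f1, f2, f3, ?_, ?_⟩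
  · rw [hq, UnitCircleLattice.r_prime_pow hp ha, ← hq]
    have hc : UnitCircleLattice.c₂ = UnitCircleLattice.c₃ * (1 + √2) := by
      rw [UnitCircleLattice.c₃, div_mul_cancel₀ _ (by positivity)]
    have h2 : (1 : ℝ) ≤ √2 := Real.one_le_sqrt.2 (by norm_num)
    have hK := (abs_nonneg _).trans e1
    rw [Nat.cast_one, div_one] at e1
    rw [hc]
    set K := (6 : ℝ) ^ (n ^ 2) * UnitCircleLattice.c₁ ^ n * UnitCircleLattice.c₃ *
          ((n : ℝ) * ((n : ℝ) + 1) / ((n - 1).factorial : ℝ)) *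
          (q : ℝ) ^ (((n : ℝ) + 2) * ((n : ℝ) - 1) / 4) with hKdef
    -- The main terms for `t = 1` and `t = p` differ by the factor `1 - 1 / p`; the two errors add
    -- to `2 K`, and `2 ≤ 1 + √2 = c₂ / c₃`.
    calc _ ≤ K + K := (abs_sub _ _).trans' (le_of_eq ?_) |>.trans (add_le_add e1 e2)
      _ ≤ K * (1 + √2) := by nlinarith
      _ = _ := by rw [hKdef]; ring
    unfold UnitCircleLattice.Lam UnitCircleLattice.Lam'
    congr 1
    field_simp
    ring
  · have hle := (abs_le.1 e3).2
    have hsq : (q : ℝ) ^ ((1 : ℝ) / 2) ≤ UnitCircleLattice.s p q := by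
      rw [← Real.sqrt_eq_rpow]
      exact Real.sqrt_le_iff.2 ⟨by positivity, by exact_mod_cast hs3⟩
    have hs0 : (0 : ℝ) < UnitCircleLattice.s p q := by exact_mod_cast hs1
    -- Since `n (n + 1) / 4 = (n + 2) (n - 1) / 4 + 1 / 2`, dividing by `s ≥ √q` brings the main
    -- term down to the order of the error.
    have hv : UnitCircleLattice.v n * (q : ℝ) ^ ((n : ℝ) * (n + 1) / 4) / UnitCircleLattice.s p q ≤
        UnitCircleLattice.v n * (q : ℝ) ^ (((n : ℝ) + 2) * ((n : ℝ) - 1) / 4) := by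
      rw [mul_div_assoc]
      refine mul_le_mul_of_nonneg_left ?_ (UnitCircleLattice.v_nonneg n)
      rw [div_le_iff₀ hs0]
      calc (q : ℝ) ^ ((n : ℝ) * (n + 1) / 4)
          = (q : ℝ) ^ (((n : ℝ) + 2) * ((n : ℝ) - 1) / 4) * (q : ℝ) ^ ((1 : ℝ) / 2) := by
            rw [← Real.rpow_add hq0]; congr 1; ring
        _ ≤ _ := mul_le_mul_of_nonneg_left hsq (by positivity)
    rw [add_mul]
    unfold UnitCircleLattice.Lam''
    linarith
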